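/- **Notation.** For $a,b\in\mathbb Z$ let $\sum_{i=a}^{b}f(i)$ be the usual sum if $a\le b$, $0$ if $b=a-1$, and $-\sum_{i=b+1}^{a-1}f(i)$ if $b+1\le a-1$. Let $E_xf(x)=f(x+1)$, $\Delta_x=E_x-\mathrm{id}$, $\delta_x=\mathrm{id}-E_x^{-1}$. For $z\in\mathbb Z$ put ${}^{z}\Delta_x^{-1}p(x)=-\sum_{x'=x}^{z}p(x')$, and for a sequence of integers $\mathbf z=(z_j)_{j<0}$ and $i<0$ put $\mathbf z_i=(z_i,z_{i+1},\dots,z_{-1})$ and ${}^{\mathbf z_i}\Delta_x^{i}={}^{z_i}\Delta_x^{-1}\,{}^{z_{i+1}}\Delta_x^{-1}\cdots{}^{z_{-1}}\Delta_x^{-1}$. Let $\alpha(n;k_1,\dots,k_n)$ be the polynomial whose value at integers $k_1<k_2<\dots<k_n$ is the number of monotone triangles with bottom row $(k_1,\dots,k_n)$, i.e. of triangular integer arrays $(a_{r,j})_{1\le j\le r\le n}$ with $a_{r,j}<a_{r,j+1}$, $a_{r+1,j}\le a_{r,j}\le a_{r+1,j+1}$ and $(a_{n,1},\dots,a_{n,n})=(k_1,\dots,k_n)$.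 For a sequence of integers $\mathbf x=(x_j)_{j<0}$ and $-n\le i\le -1$ let $$C^{(2)}_{n,i}=(-1)^i\,{}^{\mathbf x_i}\Delta^i_{k_1}\alpha(n;k_1,4,6,\dots,2n)\Big|_{k_1=3},\qquad D^{(2)}_{n,i}=(-1)^i\,{}^{\mathbf z_i}\Delta^i_{k_1}\alpha(n;k_1,4,6,\dots,2n)\Big|_{k_1=3},$$ where in the definition of $D^{(2)}_{n,i}$ the sequence is $z_j=3(n+2)-x_j-j-4$. **Conjecture A.** Let $V_{x,y}=E_x^{-1}+E_y-E_x^{-1}E_y$ and $S_{x,y}f(x,y)=f(y,x)$. Let $1\le s\le t$ and let $a(k_1,\dots,k_{s+t-1})$ be a polynomial with complex coefficients such that $(\mathrm{id}+E_{k_{i+1}}E_{k_i}^{-1}S_{k_i,k_{i+1}})V_{k_i,k_{i+1}}\,a=0$ for $1\le i\le s+t-2$. Then $$\prod_{i=1}^{s}E_{y_i}^{2s+3-2i}\delta_{y_i}^{i-1}\prod_{i=2}^{t}E_{k_i}^{2i}\delta_{k_i}^{s}\;a(y_1,\dots,y_s,k_2,\dots,k_t)=\prod_{i=2}^{t}E_{k_i}^{2i}(-\Delta_{k_i})^{s}\prod_{i=1}^{s}E_{y_i}^{2t+3-2i}(-\Delta_{y_i})^{s-i}\;a(k_2,\dots,k_t,y_1,\dots,y_s)$$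 whenever $y_1=\dots=y_s=k_2=\dots=k_t$. **Proposition.** Assume that Conjecture A is true (for all $1\le s\le t$ and all such $a$). Let $n\ge 1$, and let $\mathbf x=(x_j)_{j<0}$ with $x_j=-2j+1$ and $\mathbf z=(z_j)_{j<0}$ with $z_j=3n+j+1$. Then for all $-n\le i\le -1$: 1. ${}^{\mathbf x_i}\Delta_{k_1}^{i}\,\alpha(n;k_1,4,6,\dots,2n)\big|_{k_1=3n+2+i}=0$; 2. ${}^{\mathbf x_i}\Delta_{k_1}^{i}\,\alpha(n;k_1,4,6,\dots,2n)={}^{\mathbf z_i}\Delta_{k_1}^{i}\,\alpha(n;k_1,4,6,\dots,2n)$ for all $k_1\in\mathbb Z$; in particular $C^{(2)}_{n,i}=D^{(2)}_{n,i}$ (for this $\mathbf x$). -/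

import Mathlib

namespace VSASM

/-! ### Extended summation and difference operators in one variable -/

/-- The sum `∑_{i=a}^{b} f i` extended to all integers `a, b`: it is `0` for `b = a - 1` and
`-∑_{i=b+1}^{a-1} f i` for `b + 1 ≤ a - 1`. -/
noncomputable def extSum {M : Type*} [AddCommGroup M] (a b : ℤ) (f : ℤ → M) : M :=
  if a ≤ b + 1 then ∑ i ∈ Finset.Icc a b, f i else -∑ i ∈ Finset.Icc (b + 1) (a - 1), f i

/-- The forward difference `(Δ p)(x) = p (x + 1) - p x`. -/
def fwdDiff₁ {M : Type*} [AddCommGroup M] (p : ℤ → M) : ℤ → M :=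
  fun x => p (x + 1) - p x

/-- The right inverse difference operator `(^z Δ⁻¹ p)(x) = -∑_{x'=x}^{z} p x'`. -/
noncomputable def invDiff {M : Type*} [AddCommGroup M] (z : ℤ) (p : ℤ → M) : ℤ → M :=
  fun x => -extSum x z p

/-- `^{(z_{-m}, …, z_{-1})} Δ^{-m} = ^{z_{-m}} Δ⁻¹ ⋯ ^{z_{-1}} Δ⁻¹`, where only the values `z j` with
`-m ≤ j ≤ -1` of the sequence `z` matter. -/
noncomputable def invDiffIter {M : Type*} [AddCommGroup M] (z : ℤ → ℤ) : ℕ → (ℤ → M) → (ℤ → M)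
  | 0, p => p
  | m + 1, p => invDiff (z (-((m : ℤ) + 1))) (invDiffIter z m p)

/-- The `i`-th power of the difference operator, `i ∈ ℤ`: the ordinary `Δ^i` for `i ≥ 0`, and
`^{𝐳_i} Δ^i` with `𝐳_i = (z_i, …, z_{-1})` for `i < 0`. -/
noncomputable def diffPow {M : Type*} [AddCommGroup M] (z : ℤ → ℤ) : ℤ → (ℤ → M) → (ℤ → M)
  | Int.ofNat m, p => fwdDiff₁^[m] p
  | Int.negSucc m, p => invDiffIter z (m + 1) p

/-! ### The polynomials `α(n; k₁, …, kₙ)` -/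

/-- The summation operator `∑_{(l_1, …, l_n)}^{(k_1, …, k_{n+1})} A(l_1, …, l_n)`. -/
noncomputable def sumOp {M : Type*} [AddCommGroup M] : (n : ℕ) → ((Fin n → ℤ) → M) → (Fin (n + 1) → ℤ) → M
  | 0, A, _ => A Fin.elim0
  | n + 1, A, k =>
    sumOp n
        (fun l => extSum (k (Fin.last n).castSucc + 1) (k (Fin.last (n + 1)))
          (fun m => A (Fin.snoc l m)))
        (Fin.init k)
      + sumOp n (fun l => A (Fin.snoc l (k (Fin.last n).castSucc)))
        (Function.update (Fin.init k) (Fin.last n) (k (Fin.last n).castSucc - 1))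

/-- `α(n; k₁, …, kₙ)` at an arbitrary integer point. By `exists_polynomial_alpha` and
`alpha_eq_card` below, it is (the values of) the polynomial that counts monotone triangles with
bottom row `(k₁, …, kₙ)` whenever `k₁ < ⋯ < kₙ`. -/
noncomputable def alpha : (n : ℕ) → (Fin n → ℤ) → ℤ
  | 0, _ => 1
  | n + 1, k => sumOp n (alpha n) k

/-- Monotone triangles with `n` rows and bottom row `k`: the `i`-th row `entry i` has `i` entries
(the empty row `i = 0` is included for convenience), rows increase strictly, and
diagonals increase weakly. -/
@[ext] structure MonotoneTriangle (n : ℕ) (k : Fin n → ℤ) where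
  entry : (i : Fin (n + 1)) → Fin i → ℤ
  strictMono_row : ∀ i, StrictMono (entry i)
  le_left : ∀ (i : Fin n) (j : Fin i), entry i.succ j.castSucc ≤ entry i.castSucc j
  le_right : ∀ (i : Fin n) (j : Fin i), entry i.castSucc j ≤ entry i.succ j.succ
  bottom : entry (Fin.last n) = k

/-! #### `α` is a polynomial function -/

/-- Integer points of a polynomial. -/
def IsPolyFun {σ : Type} (f : (σ → ℤ) → ℚ) : Prop :=
  ∃ P : MvPolynomial σ ℚ, ∀ v, f v = MvPolynomial.eval (fun j => (v j : ℚ)) P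

section poly
variable {σ τ : Type}

theorem IsPolyFun.add {f g : (σ → ℤ) → ℚ} (hf : IsPolyFun f) (hg : IsPolyFun g) :
    IsPolyFun (fun v => f v + g v) := by
  obtain ⟨P, hP⟩ := hf
  obtain ⟨Q, hQ⟩ := hg
  exact ⟨P + Q, fun v => by simp [hP, hQ]⟩

theorem IsPolyFun.mul {f g : (σ → ℤ) → ℚ} (hf : IsPolyFun f) (hg : IsPolyFun g) :
    IsPolyFun (fun v => f v * g v) := by
  obtain ⟨P, hP⟩ := hf
  obtain ⟨Q, hQ⟩ := hg
  exact ⟨P * Q, fun v => by simp [hP, hQ]⟩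

theorem isPolyFun_const (c : ℚ) : IsPolyFun (fun _ : σ → ℤ => c) :=
  ⟨MvPolynomial.C c, fun v => by simp⟩

theorem isPolyFun_coord (i : σ) : IsPolyFun (fun v : σ → ℤ => (v i : ℚ)) :=
  ⟨MvPolynomial.X i, fun v => by simp⟩

theorem IsPolyFun.sub {f g : (σ → ℤ) → ℚ} (hf : IsPolyFun f) (hg : IsPolyFun g) :
    IsPolyFun (fun v => f v - g v) := by
  obtain ⟨P, hP⟩ := hf
  obtain ⟨Q, hQ⟩ := hg
  exact ⟨P - Q, fun v => by simp [hP, hQ]⟩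

theorem IsPolyFun.comp {f : (τ → ℤ) → ℚ} (hf : IsPolyFun f) {g : (σ → ℤ) → τ → ℤ}
    (hg : ∀ j, IsPolyFun (fun v => (g v j : ℚ))) : IsPolyFun (fun v => f (g v)) := by
  obtain ⟨P, hP⟩ := hf
  choose Q hQ using hg
  refine ⟨MvPolynomial.bind₁ Q P, fun v => ?_⟩
  beta_reduce
  rw [hP, ← MvPolynomial.coe_aeval_eq_eval, ← MvPolynomial.coe_aeval_eq_eval]
  simp only [RingHom.coe_coe, MvPolynomial.aeval_bind₁]
  congr 2
  funext j
  rw [show ((g v j : ℤ) : ℚ) = _ from hQ j v, ← MvPolynomial.coe_aeval_eq_eval]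
  rfl

theorem isPolyFun_polynomial (p : Polynomial ℚ) {f : (σ → ℤ) → ℚ} (hf : IsPolyFun f) :
    IsPolyFun (fun v => p.eval (f v)) := by
  obtain ⟨P, hP⟩ := hf
  refine ⟨Polynomial.aeval P p, fun v => ?_⟩
  beta_reduce
  rw [hP, Polynomial.aeval_def, Polynomial.hom_eval₂]
  simp [Polynomial.eval, Polynomial.eval₂_eq_sum_range]

theorem extSum_eq_sub {M : Type*} [AddCommGroup M] {f F : ℤ → M}
    (h : ∀ x, F x - F (x - 1) = f x) (a b : ℤ) : extSum a b f = F b - F (a - 1) := by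
  have key : ∀ (a : ℤ) (m : ℕ), ∑ i ∈ Finset.Icc a (a - 1 + m), f i
      = F (a - 1 + m) - F (a - 1) := by
    intro a m
    induction m with
    | zero => simp
    | succ m ih =>
      have hI : Finset.Icc a (a - 1 + ((m + 1 : ℕ) : ℤ))
          = insert (a + m) (Finset.Icc a (a - 1 + m)) := by
        ext x
        simp only [Finset.mem_Icc, Finset.mem_insert]
        push_cast
        omega
      rw [hI, Finset.sum_insert (by simp), ih, ← h,
        show a + (m : ℤ) - 1 = a - 1 + m by ring,
        show a - 1 + ((m + 1 : ℕ) : ℤ) = a + m by push_cast; ring]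
      abel
  unfold extSum
  split_ifs with hab
  · have := key a (b - a + 1).toNat
    rwa [show a - 1 + (((b - a + 1).toNat : ℕ) : ℤ) = b by omega] at this
  · have := key (b + 1) (a - 1 - b).toNat
    rw [show b + 1 - 1 + (((a - 1 - b).toNat : ℕ) : ℤ) = a - 1 by omega,
      show b + 1 - 1 = b by ring] at this
    rw [this]
    abel

theorem exists_antidiff (P : MvPolynomial (σ ⊕ Unit) ℚ) (e : ℕ) :
    ∃ H : (σ ⊕ Unit → ℤ) → ℚ, IsPolyFun H ∧ ∀ (θ : σ → ℤ) (x : ℤ),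
      H (Sum.elim θ fun _ => x) - H (Sum.elim θ fun _ => x - 1)
        = MvPolynomial.eval (fun j => ((Sum.elim θ (fun _ => x) j : ℤ) : ℚ)) P * (x : ℚ) ^ e := by
  induction P using MvPolynomial.induction_on generalizing e with
  | C c =>
    refine ⟨fun v => c / (e + 1) *
      (Polynomial.bernoulli (e + 1)).eval (1 + (v (Sum.inr ()) : ℚ)),
      (isPolyFun_const _).mul (isPolyFun_polynomial _
        ((isPolyFun_const 1).add (isPolyFun_coord _))), fun θ x => ?_⟩
    have h := Polynomial.bernoulli_eval_one_add (e + 1) (x : ℚ)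
    have he : (e : ℚ) + 1 ≠ 0 := by positivity
    simp only [Sum.elim_inr, MvPolynomial.eval_C, Int.cast_sub, Int.cast_one,
      add_sub_cancel]
    rw [h]
    push_cast
    field_simp
    ring
  | add P Q hP hQ =>
    obtain ⟨H₁, p₁, h₁⟩ := hP e
    obtain ⟨H₂, p₂, h₂⟩ := hQ e
    refine ⟨_, p₁.add p₂, fun θ x => ?_⟩
    have := h₁ θ x
    have := h₂ θ x
    simp only [map_add, add_mul]
    linarith
  | mul_X P i hP =>
    rcases i with i | u
    · obtain ⟨H, p, h⟩ := hP e
      refine ⟨_, p.mul (isPolyFun_coord (Sum.inl i)), fun θ x => ?_⟩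
      have := h θ x
      simp only [Sum.elim_inl, map_mul, MvPolynomial.eval_X]
      rw [← sub_mul, this]
      ring
    · obtain ⟨H, p, h⟩ := hP (e + 1)
      refine ⟨H, p, fun θ x => ?_⟩
      rw [h]
      simp only [map_mul, MvPolynomial.eval_X, Sum.elim_inr]
      ring

theorem IsPolyFun.extSum {G : (σ → ℤ) → ℤ → ℚ}
    (hG : IsPolyFun (fun v : σ ⊕ Unit → ℤ => G (v ∘ Sum.inl) (v (Sum.inr ()))))
    {a b : (σ → ℤ) → ℤ} (ha : IsPolyFun (fun θ => (a θ : ℚ))) (hb : IsPolyFun (fun θ => (b θ : ℚ))) :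
    IsPolyFun (fun θ => VSASM.extSum (a θ) (b θ) (G θ)) := by
  obtain ⟨P, hP⟩ := hG
  obtain ⟨H, hH, hH'⟩ := exists_antidiff P 0
  have : ∀ θ, VSASM.extSum (a θ) (b θ) (G θ)
      = H (Sum.elim θ fun _ => b θ) - H (Sum.elim θ fun _ => a θ - 1) := by
    intro θ
    refine extSum_eq_sub (F := fun x => H (Sum.elim θ fun _ => x)) (fun x => ?_) _ _
    have h1 := hP (Sum.elim θ fun _ => x)
    simp only [Sum.elim_comp_inl, Sum.elim_inr] at h1
    rw [hH', h1]
    simp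
  simp only [this]
  refine (hH.comp ?_).sub (hH.comp ?_)
  · rintro (j | j)
    · exact isPolyFun_coord j
    · exact hb
  · rintro (j | j)
    · exact isPolyFun_coord j
    · simpa using ha.sub (isPolyFun_const 1)

theorem IsPolyFun.sumOp (n : ℕ) {σ : Type} {F : (σ → ℤ) → (Fin n → ℤ) → ℚ}
    (hF : IsPolyFun (fun v : σ ⊕ Fin n → ℤ => F (v ∘ Sum.inl) (v ∘ Sum.inr)))
    {K : (σ → ℤ) → Fin (n + 1) → ℤ} (hK : ∀ j, IsPolyFun (fun θ => (K θ j : ℚ))) :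
    IsPolyFun (fun θ => VSASM.sumOp n (F θ) (K θ)) := by
  induction n generalizing σ with
  | zero =>
    have := hF.comp (g := fun (θ : σ → ℤ) => Sum.elim θ Fin.elim0)
      (by rintro (j | j)
          · exact isPolyFun_coord j
          · exact j.elim0)
    simpa [VSASM.sumOp] using this
  | succ n ih =>
    simp only [VSASM.sumOp]
    refine IsPolyFun.add (ih ?_ ?_) (ih ?_ ?_)
    · refine IsPolyFun.extSum (σ := σ ⊕ Fin n)
        (G := fun v m => F (v ∘ Sum.inl) (Fin.snoc (v ∘ Sum.inr) m)) ?_ ?_ ?_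
      · refine hF.comp (g := fun v : (σ ⊕ Fin n) ⊕ Unit → ℤ => Sum.elim (v ∘ Sum.inl ∘ Sum.inl)
          (Fin.snoc (v ∘ Sum.inl ∘ Sum.inr) (v (Sum.inr ())) : Fin (n + 1) → ℤ)) ?_
        rintro (j | j)
        · exact isPolyFun_coord _
        · refine Fin.lastCases ?_ (fun j => ?_) j
          · simpa using isPolyFun_coord _
          · simpa using isPolyFun_coord (σ := (σ ⊕ Fin n) ⊕ Unit) (Sum.inl (Sum.inr j))
      · have := ((hK (Fin.last n).castSucc).add (isPolyFun_const 1)).comp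
          (g := fun v : σ ⊕ Fin n → ℤ => v ∘ Sum.inl) (fun j => isPolyFun_coord _)
        simpa using this
      · exact (hK (Fin.last (n + 1))).comp
          (g := fun v : σ ⊕ Fin n → ℤ => v ∘ Sum.inl) (fun j => isPolyFun_coord _)
    · intro j
      exact hK j.castSucc
    · refine hF.comp (g := fun v : σ ⊕ Fin n → ℤ => Sum.elim (v ∘ Sum.inl)
          (Fin.snoc (v ∘ Sum.inr) (K (v ∘ Sum.inl) (Fin.last n).castSucc) : Fin (n + 1) → ℤ)) ?_
      rintro (j | j)
      · exact isPolyFun_coord _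
      · refine Fin.lastCases ?_ (fun j => ?_) j
        · simpa using (hK (Fin.last n).castSucc).comp
            (g := fun v : σ ⊕ Fin n → ℤ => v ∘ Sum.inl) (fun j => isPolyFun_coord _)
        · simpa using isPolyFun_coord (σ := σ ⊕ Fin n) (Sum.inr j)
    · intro j
      by_cases h : j = Fin.last n
      · subst h
        simpa using (hK (Fin.last n).castSucc).sub (isPolyFun_const 1)
      · simpa [Function.update_of_ne h, Fin.init] using hK j.castSucc

theorem extSum_cast (a b : ℤ) (f : ℤ → ℤ) :
    ((extSum a b f : ℤ) : ℚ) = extSum a b (fun i => (f i : ℚ)) := by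
  unfold extSum
  split_ifs <;> push_cast <;> rfl

theorem sumOp_cast (n : ℕ) (A : (Fin n → ℤ) → ℤ) (k : Fin (n + 1) → ℤ) :
    ((sumOp n A k : ℤ) : ℚ) = sumOp n (fun l => (A l : ℚ)) k := by
  induction n with
  | zero => rfl
  | succ n ih =>
    simp only [sumOp]
    push_cast
    rw [ih, ih]
    simp only [extSum_cast]

end poly

/-- `α(n; ·)` is a polynomial function. -/
theorem exists_polynomial_alpha (n : ℕ) : ∃ P : MvPolynomial (Fin n) ℚ, ∀ k : Fin n → ℤ,
    (alpha n k : ℚ) = MvPolynomial.eval (fun j => (k j : ℚ)) P := by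
  induction n with
  | zero => exact ⟨1, fun k => by simp [alpha]⟩
  | succ n ih =>
    have h : IsPolyFun (fun l : Fin n → ℤ => (alpha n l : ℚ)) := ih
    have := IsPolyFun.sumOp n (σ := Fin (n + 1)) (F := fun _ l => (alpha n l : ℚ))
      (h.comp (g := fun v : Fin (n + 1) ⊕ Fin n → ℤ => v ∘ Sum.inr) fun j => isPolyFun_coord _)
      (K := fun θ => θ) (fun j => isPolyFun_coord j)
    obtain ⟨P, hP⟩ := this
    exact ⟨P, fun k => by rw [← hP k, alpha, sumOp_cast]⟩

/-! #### `α` counts monotone triangles -/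

open Classical in
/-- The possible penultimate rows over the bottom row `k`. -/
noncomputable def interlacing (n : ℕ) (k : Fin (n + 1) → ℤ) : Finset (Fin n → ℤ) :=
  (Fintype.piFinset fun j => Finset.Icc (k j.castSucc) (k j.succ)).filter StrictMono

theorem mem_interlacing {n : ℕ} {k : Fin (n + 1) → ℤ} {l : Fin n → ℤ} :
    l ∈ interlacing n k ↔ (∀ j, k j.castSucc ≤ l j ∧ l j ≤ k j.succ) ∧ StrictMono l := by
  simp [interlacing]

theorem mem_interlacing_snoc {n : ℕ} {k : Fin (n + 2) → ℤ} {l : Fin n → ℤ} {m : ℤ} :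
    (Fin.snoc l m : Fin (n + 1) → ℤ) ∈ interlacing (n + 1) k ↔
      ((∀ j : Fin n, k j.castSucc.castSucc ≤ l j ∧ l j ≤ k j.succ.castSucc) ∧ StrictMono l) ∧
      (k (Fin.last n).castSucc ≤ m ∧ m ≤ k (Fin.last (n + 1))) ∧ ∀ j, l j < m := by
  have hs : StrictMono (Fin.snoc l m : Fin (n + 1) → ℤ) ↔ StrictMono l ∧ ∀ j, l j < m := by
    constructor
    · intro h
      refine ⟨fun a b hab => ?_, fun j => ?_⟩
      · simpa using h (Fin.castSucc_lt_castSucc_iff.2 hab)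
      · simpa using h (Fin.castSucc_lt_last j)
    · rintro ⟨h1, h2⟩ a b hab
      induction b using Fin.lastCases with
      | last =>
        induction a using Fin.lastCases with
        | last => exact absurd hab (lt_irrefl _)
        | cast a => simpa using h2 a
      | cast b =>
        induction a using Fin.lastCases with
        | last => exact absurd hab (not_lt.2 (Fin.le_last _))
        | cast a => simpa using h1 (Fin.castSucc_lt_castSucc_iff.1 hab)
  rw [mem_interlacing, hs, Fin.forall_fin_succ']
  simp only [Fin.snoc_castSucc, Fin.snoc_last, Fin.succ_last, Fin.succ_castSucc]
  tauto

theorem sumOp_eq_sum {M : Type*} [AddCommGroup M] (n : ℕ) (A : (Fin n → ℤ) → M)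
    (k : Fin (n + 1) → ℤ) (hk : StrictMono (Fin.init k))
    (hk' : ∀ j : Fin n, k j.castSucc ≤ k (Fin.last n)) :
    sumOp n A k = ∑ l ∈ interlacing n k, A l := by
  induction n with
  | zero =>
    have : interlacing 0 k = {Fin.elim0} := by
      ext l
      simp [mem_interlacing, Subsingleton.elim l Fin.elim0, Subsingleton.strictMono]
    simp [this, sumOp]
  | succ n ih =>
    have hlast : k (Fin.last n).castSucc ≤ k (Fin.last (n + 1)) := hk' (Fin.last n)
    have hlt : ∀ j : Fin n, k j.castSucc.castSucc < k (Fin.last n).castSucc :=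
      fun j => hk (Fin.castSucc_lt_last j)
    have hinit : StrictMono (Fin.init (Fin.init k : Fin (n + 1) → ℤ)) :=
      fun a b hab => hk (Fin.castSucc_lt_castSucc_iff.2 hab)
    rw [sumOp, ih _ (Fin.init k) hinit fun j => (hlt j).le, ih]
    rotate_left
    · rw [Fin.init_update_last]
      exact hinit
    · intro j
      rw [Function.update_of_ne (Fin.castSucc_lt_last j).ne, Function.update_self]
      exact Int.le_sub_one_of_lt (hlt j)
    rw [← Finset.sum_filter_add_sum_filter_not (interlacing (n + 1) k)
      (fun l => k (Fin.last n).castSucc < l (Fin.last n))]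
    congr 1
    · simp only [extSum, if_pos (show k (Fin.last n).castSucc + 1 ≤ k (Fin.last (n + 1)) + 1 by
        omega)]
      rw [← Finset.sum_product']
      refine Finset.sum_bij' (fun p _ => Fin.snoc p.1 p.2)
        (fun l _ => (Fin.init l, l (Fin.last n))) ?_ ?_ ?_ ?_ ?_
      · rintro ⟨l, m⟩ h
        simp only [Finset.mem_product, Finset.mem_Icc] at h
        obtain ⟨h1, h2⟩ := h
        rw [mem_interlacing] at h1
        rw [Finset.mem_filter, mem_interlacing_snoc]
        refine ⟨⟨⟨h1.1, h1.2⟩, ⟨by omega, h2.2⟩, fun j => ?_⟩, by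
          simp only [Fin.snoc_last]; omega⟩
        have a1 := (h1.1 j).2
        have a2 : k j.succ.castSucc ≤ k (Fin.last n).castSucc := hk.monotone (Fin.le_last j.succ)
        simp only [Fin.init] at a1 h2
        show l j < m
        omega
      · intro l h
        obtain ⟨h1, h2⟩ := Finset.mem_filter.1 h
        rw [← Fin.snoc_init_self l, mem_interlacing_snoc] at h1
        rw [Finset.mem_product, mem_interlacing, Finset.mem_Icc]
        exact ⟨⟨h1.1.1, h1.1.2⟩, by simp only; omega, h1.2.1.2⟩
      · rintro ⟨l, m⟩ _
        simp
      · intro l _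
        simp
      · rintro ⟨l, m⟩ _
        rfl
    · refine Finset.sum_bij' (fun l _ => Fin.snoc l (k (Fin.last n).castSucc))
        (fun l _ => Fin.init l) ?_ ?_ ?_ ?_ ?_
      · intro l h
        rw [mem_interlacing] at h
        rw [Finset.mem_filter, mem_interlacing_snoc]
        have hb : ∀ j : Fin n, l j ≤ k j.succ.castSucc ∧ l j < k (Fin.last n).castSucc := by
          intro j
          have a1 := (h.1 j).2
          by_cases hj : j.succ = Fin.last n
          · rw [hj, Function.update_self] at a1
            rw [hj]
            omega
          · rw [Function.update_of_ne hj] at a1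
            have a2 : k j.succ.castSucc ≤ k (Fin.last n).castSucc :=
              hk.monotone (Fin.le_last j.succ)
            have a3 : k j.succ.castSucc < k (Fin.last n).castSucc :=
              hk (lt_of_le_of_ne (Fin.le_last _) hj)
            simp only [Fin.init] at a1
            omega
        refine ⟨⟨⟨fun j => ⟨?_, (hb j).1⟩, h.2⟩, ⟨le_rfl, hlast⟩, fun j => (hb j).2⟩, by simp⟩
        have a1 := (h.1 j).1
        rwa [Function.update_of_ne (Fin.castSucc_lt_last j).ne] at a1
      · intro l h
        obtain ⟨h1, h2⟩ := Finset.mem_filter.1 h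
        rw [← Fin.snoc_init_self l, mem_interlacing_snoc] at h1
        rw [mem_interlacing]
        refine ⟨fun j => ⟨?_, ?_⟩, h1.1.2⟩
        · rw [Function.update_of_ne (Fin.castSucc_lt_last j).ne]
          exact (h1.1.1 j).1
        · have a1 := h1.2.2 j
          by_cases hj : j.succ = Fin.last n
          · rw [hj, Function.update_self]
            omega
          · rw [Function.update_of_ne hj]
            exact (h1.1.1 j).2
      · intro l _
        simp
      · intro l h
        obtain ⟨h1, h2⟩ := Finset.mem_filter.1 h
        rw [← Fin.snoc_init_self l, mem_interlacing_snoc] at h1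
        have : k (Fin.last n).castSucc = l (Fin.last n) := by omega
        rw [this, Fin.snoc_init_self]
      · intro l _
        rfl

theorem MonotoneTriangle.sigma_ext {n : ℕ} {s : Finset (Fin n → ℤ)}
    {p q : Σ l : s, MonotoneTriangle n l.1} (h : p.2.entry = q.2.entry) : p = q := by
  obtain ⟨⟨l, hl⟩, ⟨e, h1, h2, h3, h4⟩⟩ := p
  obtain ⟨⟨l', hl'⟩, ⟨e', h1', h2', h3', h4'⟩⟩ := q
  change e = e' at h
  change e (Fin.last n) = l at h4
  change e' (Fin.last n) = l' at h4'
  subst h h4 h4'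
  rfl

/-- Removing the bottom row of a monotone triangle. -/
def MonotoneTriangle.equivSigma (n : ℕ) (k : Fin (n + 1) → ℤ) (hk : StrictMono k) :
    MonotoneTriangle (n + 1) k ≃ Σ l : interlacing n k, MonotoneTriangle n l.1 where
  toFun T := ⟨⟨T.entry (Fin.last n).castSucc, mem_interlacing.2
      ⟨fun j => by
        have h1 := T.le_left (Fin.last n) j
        have h2 := T.le_right (Fin.last n) j
        have hb : T.entry (Fin.last n).succ = k := T.bottom
        rw [hb] at h1 h2
        exact ⟨h1, h2⟩, T.strictMono_row _⟩⟩,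
    { entry := fun i => T.entry i.castSucc
      strictMono_row := fun i => T.strictMono_row i.castSucc
      le_left := fun i j => T.le_left i.castSucc j
      le_right := fun i j => T.le_right i.castSucc j
      bottom := rfl }⟩
  invFun p :=
    { entry := Fin.snoc (α := fun i : Fin (n + 2) => Fin i → ℤ) p.2.entry k
      strictMono_row := by
        intro i
        induction i using Fin.lastCases with
        | last => rw [Fin.snoc_last]; exact hk
        | cast i => rw [Fin.snoc_castSucc]; exact p.2.strictMono_row i
      le_left := by
        intro i
        induction i using Fin.lastCases with
        | last =>
          intro j
          rw [Fin.snoc_castSucc]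
          have := (mem_interlacing.1 p.1.2).1 j
          have hb := congrFun p.2.bottom j
          have hs : Fin.snoc (α := fun i : Fin (n + 2) => Fin i → ℤ) p.2.entry k
              (Fin.last n).succ = k := Fin.snoc_last (α := fun i : Fin (n + 2) => Fin i → ℤ) _ _
          rw [hs, hb]
          exact this.1
        | cast i =>
          intro j
          rw [Fin.snoc_castSucc]
          have hs : Fin.snoc (α := fun i : Fin (n + 2) => Fin i → ℤ) p.2.entry k
              (i.castSucc).succ = p.2.entry i.succ :=
            Fin.snoc_castSucc (α := fun i : Fin (n + 2) => Fin i → ℤ) _ _ i.succ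
          rw [hs]
          exact p.2.le_left i j
      le_right := by
        intro i
        induction i using Fin.lastCases with
        | last =>
          intro j
          rw [Fin.snoc_castSucc]
          have := (mem_interlacing.1 p.1.2).1 j
          have hb := congrFun p.2.bottom j
          have hs : Fin.snoc (α := fun i : Fin (n + 2) => Fin i → ℤ) p.2.entry k
              (Fin.last n).succ = k := Fin.snoc_last (α := fun i : Fin (n + 2) => Fin i → ℤ) _ _
          rw [hs, hb]
          exact this.2
        | cast i =>
          intro j
          rw [Fin.snoc_castSucc]
          have hs : Fin.snoc (α := fun i : Fin (n + 2) => Fin i → ℤ) p.2.entry k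
              (i.castSucc).succ = p.2.entry i.succ :=
            Fin.snoc_castSucc (α := fun i : Fin (n + 2) => Fin i → ℤ) _ _ i.succ
          rw [hs]
          exact p.2.le_right i j
      bottom := Fin.snoc_last (α := fun i : Fin (n + 2) => Fin i → ℤ) _ _ }
  left_inv T := by
    apply MonotoneTriangle.ext
    funext i
    induction i using Fin.lastCases with
    | last => simp only [Fin.snoc_last]; exact T.bottom.symm
    | cast i => simp only [Fin.snoc_castSucc]
  right_inv := by
    intro p
    refine sigma_ext (funext fun i => ?_)
    exact Fin.snoc_castSucc (α := fun i : Fin (n + 2) => Fin i → ℤ) _ _ i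

theorem MonotoneTriangle.finite_and_card (n : ℕ) (k : Fin n → ℤ) (hk : StrictMono k) :
    Finite (MonotoneTriangle n k) ∧ (Nat.card (MonotoneTriangle n k) : ℤ) = alpha n k := by
  induction n with
  | zero =>
    have hs : Subsingleton (MonotoneTriangle 0 k) := ⟨fun S T => by
      apply MonotoneTriangle.ext
      funext i j
      exact absurd j.2 (by omega)⟩
    have hn : Nonempty (MonotoneTriangle 0 k) := ⟨
      { entry := fun i _ => 0
        strictMono_row := fun i a => absurd a.2 (by omega)
        le_left := fun i => i.elim0
        le_right := fun i => i.elim0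
        bottom := funext fun i => i.elim0 }⟩
    refine ⟨inferInstance, ?_⟩
    rw [Nat.card_eq_one_iff_unique.2 ⟨hs, hn⟩]
    simp [alpha]
  | succ n ih =>
    have hl : ∀ l : interlacing n k, StrictMono l.1 := fun l => (mem_interlacing.1 l.2).2
    have hf : ∀ l : interlacing n k, Finite (MonotoneTriangle n l.1) := fun l => (ih _ (hl l)).1
    refine ⟨Finite.of_equiv _ (equivSigma n k hk).symm, ?_⟩
    rw [Nat.card_congr (equivSigma n k hk), Nat.card_sigma, alpha,
      sumOp_eq_sum n _ k (fun a b hab => hk (Fin.castSucc_lt_castSucc_iff.2 hab))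
        (fun j => hk.monotone (Fin.le_last _)), ← Finset.sum_coe_sort (interlacing n k)]
    push_cast
    exact Finset.sum_congr rfl fun l _ => (ih _ (hl l)).2

/-- If `k₁ < ⋯ < kₙ`, then `α(n; k₁, …, kₙ)` is the number of monotone triangles with bottom row
`(k₁, …, kₙ)`. -/
theorem alpha_eq_card (n : ℕ) (k : Fin n → ℤ) (hk : StrictMono k) :
    alpha n k = Nat.card (MonotoneTriangle n k) :=
  (MonotoneTriangle.finite_and_card n k hk).2.symm

/-! ### The numbers `C_{n,i}^{(d)}` and `D_{n,i}^{(d)}` -/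

/-- The function `k₁ ↦ α(n; k₁, 2d, 3d, …, nd)`. -/
noncomputable def alphaRow (n : ℕ) (d : ℤ) (k₁ : ℤ) : ℤ :=
  alpha n (fun j : Fin n => if (j : ℕ) = 0 then k₁ else ((j : ℤ) + 1) * d)

/-- `C_{n,i}^{(d)} = (-1)^i Δ_{k₁}^i α(n; k₁, 2d, …, nd)` at `k₁ = d + 1`, where for `i < 0`
the operator is `^{𝐱_i} Δ_{k₁}^i` with `𝐱_i = (x_i, …, x_{-1})`. -/
noncomputable def Cnum (x : ℤ → ℤ) (n : ℕ) (d i : ℤ) : ℤ :=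
  (i.negOnePow : ℤ) * diffPow x i (alphaRow n d) (d + 1)

/-- `D_{n,i}^{(d)}`: as `C_{n,i}^{(d)}`, but with the sequence
`z_j = (n + 2) (d + 1) - x_j - j - 4` in place of `x_j`. -/
noncomputable def Dnum (x : ℤ → ℤ) (n : ℕ) (d i : ℤ) : ℤ :=
  (i.negOnePow : ℤ) *
    diffPow (fun j => ((n : ℤ) + 2) * (d + 1) - x j - j - 4) i (alphaRow n d) (d + 1)

/-! ### Operators in several variables and the conjecture -/

section operators
variable {ι : Type*} [DecidableEq ι]

/-- The power `E_j^c`, `c ∈ ℤ`, of the shift operator in the variable `j`. -/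
def E (j : ι) (c : ℤ) : Module.End ℂ ((ι → ℤ) → ℂ) where
  toFun f := fun k => f (Function.update k j (k j + c))
  map_add' _ _ := rfl
  map_smul' _ _ := rfl

/-- `Δ_j = E_j - id`. -/
def Δ (j : ι) : Module.End ℂ ((ι → ℤ) → ℂ) := E j 1 - 1

/-- `δ_j = id - E_j⁻¹`. -/
def δ (j : ι) : Module.End ℂ ((ι → ℤ) → ℂ) := 1 - E j (-1)

/-- `S_{x,y} f(x, y) = f(y, x)`. -/
def S (x y : ι) : Module.End ℂ ((ι → ℤ) → ℂ) where
  toFun f := fun k => f (k ∘ Equiv.swap x y)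
  map_add' _ _ := rfl
  map_smul' _ _ := rfl

/-- `V_{x,y} = E_x⁻¹ + E_y - E_x⁻¹ E_y`. -/
def V (x y : ι) : Module.End ℂ ((ι → ℤ) → ℂ) := E x (-1) + E y 1 - E x (-1) * E y 1

/-- The product of finitely many operators (all products below are of commuting ones). -/
def prodOp {m : ℕ} (T : Fin m → Module.End ℂ ((ι → ℤ) → ℂ)) : Module.End ℂ ((ι → ℤ) → ℂ) :=
  (List.ofFn T).prod

end operators

/-- `(id + E_{k_{i+1}} E_{k_i}⁻¹ S_{k_i,k_{i+1}}) V_{k_i,k_{i+1}} a = 0` for all pairs of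
consecutive variables. -/
def ShiftAntisymmetric {m : ℕ} (a : (Fin m → ℤ) → ℂ) : Prop :=
  ∀ i j : Fin m, (i : ℕ) + 1 = j → ((1 + E j 1 * E i (-1) * S i j) * V i j) a = 0

/-- The function of `(y₁, …, y_s, k₂, …, k_t)` given by `a(y₁, …, y_s, k₂, …, k_t)`; the variable
`y_i` has index `inl (i - 1)`, the variable `k_i` has index `inr (i - 2)`. -/
def substYK {s r : ℕ} (a : (Fin (s + r) → ℤ) → ℂ) (v : Fin s ⊕ Fin r → ℤ) : ℂ :=
  a (Fin.append (v ∘ Sum.inl) (v ∘ Sum.inr))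

/-- The function of `(y₁, …, y_s, k₂, …, k_t)` given by `a(k₂, …, k_t, y₁, …, y_s)`. -/
def substKY {s r : ℕ} (a : (Fin (s + r) → ℤ) → ℂ) (v : Fin s ⊕ Fin r → ℤ) : ℂ :=
  a (Fin.append (v ∘ Sum.inr) (v ∘ Sum.inl) ∘ Fin.cast (Nat.add_comm s r))

/-- `∏_{i=1}^s E_{y_i}^{2s+3-2i} δ_{y_i}^{i-1} ∏_{i=2}^t E_{k_i}^{2i} δ_{k_i}^s`. -/
def opLeft (s t : ℕ) :
    Module.End ℂ ((Fin s ⊕ Fin (t - 1) → ℤ) → ℂ) :=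
  prodOp (fun i : Fin s => E (Sum.inl i) (2 * s + 3 - 2 * ((i : ℤ) + 1)) * δ (Sum.inl i) ^ (i : ℕ)) *
    prodOp (fun i : Fin (t - 1) => E (Sum.inr i) (2 * ((i : ℤ) + 2)) * δ (Sum.inr i) ^ s)

/-- `∏_{i=2}^t E_{k_i}^{2i} (-Δ_{k_i})^s ∏_{i=1}^s E_{y_i}^{2t+3-2i} (-Δ_{y_i})^{s-i}`. -/
def opRight (s t : ℕ) :
    Module.End ℂ ((Fin s ⊕ Fin (t - 1) → ℤ) → ℂ) :=
  prodOp (fun i : Fin (t - 1) => E (Sum.inr i) (2 * ((i : ℤ) + 2)) * (-Δ (Sum.inr i)) ^ s) *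
    prodOp (fun i : Fin s =>
      E (Sum.inl i) (2 * t + 3 - 2 * ((i : ℤ) + 1)) * (-Δ (Sum.inl i)) ^ (s - ((i : ℕ) + 1)))

/-- The conjecture: for all `1 ≤ s ≤ t` and every polynomial `a` in `s + t - 1` variables that is
shift-antisymmetric, `opLeft` applied to `a(y₁, …, y_s, k₂, …, k_t)` and `opRight` applied to
`a(k₂, …, k_t, y₁, …, y_s)` agree wherever `y₁ = ⋯ = y_s = k₂ = ⋯ = k_t`. Polynomials are regarded
as functions on integer points, which determine them. -/
def OperatorConjecture : Prop :=
  ∀ s t : ℕ, 1 ≤ s → s ≤ t →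
    ∀ P : MvPolynomial (Fin (s + (t - 1))) ℂ, ∀ a : (Fin (s + (t - 1)) → ℤ) → ℂ,
      (∀ k, a k = MvPolynomial.eval (fun j => (k j : ℂ)) P) →
      ShiftAntisymmetric a →
      ∀ c : ℤ, opLeft s t (substYK a) (fun _ => c) = opRight s t (substKY a) (fun _ => c)

end VSASM

/-! Freeze the first variable of α at `u` and apply the conjecture, with `s = -i`, `t = n` and all
variables equal to `0`, to `v ↦ α(s + n; u, v)`. Each side then collapses to an iterated inverse
difference of `u ↦ α(n; u, 4, 6, …, 2n)`, one with the limits `𝐱_i`, the other with `𝐳_i`; the two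
signs `(-1)^s` agree and cancel. This gives item 2. Item 1 follows because the outermost operator on
the `𝐳` side is `-∑_{x' = x}^{z_i}`, an empty sum at `x = z_i + 1 = 3n + 2 + i`.

The collapse rests on two reductions. Applying `δ` to every variable of `v` except the first turns
`α(u, v)` into the extended sum of `α(l, v')` for `l` from `u` to the first entry of `v`, where `v'`
drops that entry (`act_prod_bwd_alphaC`). Applying `-Δ` to every variable of `v` except the last
gives the same kind of sum, with the last entry dropped and the upper limit shifted
(`act_prod_fwd_alphaC`). The exponents of `δ` and `-Δ` in the conjecture allow exactly `s` such
reductions, and the shifts supply the limits and leave the bottom row `4, 6, …, 2n`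
(`act_prod_bwd_pow`, `act_prod_fwd_pow`).

The first reduction comes from writing α as an alternating sum, over the omitted argument, of an
antidifference of the previous α (`alphaC_succ`): a difference in a variable kills the term omitting
it. The second follows from the first by the circular symmetry of α (`alphaC_snoc`). Both, and the
shift-antisymmetry needed for the conjecture, rest on the operator formula `alphaC_eq`, which
expresses α as `∏_{p<q} V_{q,p}` applied to a Vandermonde product. All operators are elements of a
commutative group ring of shifts acting on functions. -/

namespace VSASM

/-! ### The group ring of shifts acting on functions on integer points -/

/-- Laurent polynomials in the shift operators. -/
abbrev ShiftRing (ι : Type*) := AddMonoidAlgebra ℂ (ι → ℤ)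

section act
variable {ι κ : Type*}

/-- Translation of the argument as a monoid homomorphism into operators. -/
def translate : Multiplicative (ι → ℤ) →* Module.End ℂ ((ι → ℤ) → ℂ) where
  toFun w :=
    { toFun := fun f k => f (k + w.toAdd)
      map_add' := fun _ _ => rfl
      map_smul' := fun _ _ => rfl }
  map_one' := by
    ext f k
    simp
  map_mul' v w := by
    refine LinearMap.ext fun f => funext fun k => ?_
    simp [add_assoc]

/-- The action of Laurent polynomials in the shift operators on functions. -/
noncomputable def act : ShiftRing ι →ₐ[ℂ] Module.End ℂ ((ι → ℤ) → ℂ) :=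
  AddMonoidAlgebra.lift ℂ _ _ translate

theorem act_single (w : ι → ℤ) (c : ℂ) (f : (ι → ℤ) → ℂ) (k : ι → ℤ) :
    act (AddMonoidAlgebra.single w c) f k = c * f (k + w) := by
  simp [act, AddMonoidAlgebra.lift_single, translate]

theorem act_mul_apply (a b : ShiftRing ι) (f : (ι → ℤ) → ℂ) :
    act (a * b) f = act a (act b f) := by
  rw [map_mul, Module.End.mul_apply]

theorem act_comm (a b : ShiftRing ι) (f : (ι → ℤ) → ℂ) :
    act a (act b f) = act b (act a f) := by
  rw [← act_mul_apply, mul_comm, act_mul_apply]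

/-- The ring homomorphism of shift rings induced by an additive map of lattices. -/
noncomputable def pushShift (φ : (κ → ℤ) →+ (ι → ℤ)) : ShiftRing κ →+* ShiftRing ι :=
  AddMonoidAlgebra.mapDomainRingHom ℂ φ

theorem pushShift_single (φ : (κ → ℤ) →+ (ι → ℤ)) (w : κ → ℤ) (c : ℂ) :
    pushShift φ (AddMonoidAlgebra.single w c) = AddMonoidAlgebra.single (φ w) c := by
  simp [pushShift]

/-- Shift operators commute with an affine substitution. -/
theorem act_comp (T : (κ → ℤ) → (ι → ℤ)) (φ : (κ → ℤ) →+ (ι → ℤ))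
    (hT : ∀ v w, T (v + w) = T v + φ w) (a : ShiftRing κ) (f : (ι → ℤ) → ℂ) (k : κ → ℤ) :
    act a (fun v => f (T v)) k = act (pushShift φ a) f (T k) := by
  induction a using AddMonoidAlgebra.induction_linear with
  | zero => simp
  | add a b ha hb => simp [map_add, ha, hb]
  | single w c => rw [pushShift_single, act_single, act_single, hT]

/-- Reindexing of coordinates as an additive map. -/
def reindexHom (σ : ι → κ) : (κ → ℤ) →+ (ι → ℤ) where
  toFun v := v ∘ σ
  map_zero' := rfl
  map_add' _ _ := rfl

theorem prodOp_act {m : ℕ} (a : Fin m → ShiftRing ι) :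
    prodOp (fun i => act (a i)) = act (∏ i, a i) := by
  rw [prodOp, ← List.prod_ofFn, map_list_prod, List.map_ofFn]
  rfl

variable [DecidableEq ι] [DecidableEq κ]

/-- The shift by `c` in the variable `i`. -/
noncomputable def shiftBy (i : ι) (c : ℤ) : ShiftRing ι := AddMonoidAlgebra.single (Pi.single i c) 1

/-- The backward difference as an element of the shift ring. -/
noncomputable def bwd (i : ι) : ShiftRing ι := 1 - shiftBy i (-1)

/-- The forward difference as an element of the shift ring. -/
noncomputable def fwd (i : ι) : ShiftRing ι := shiftBy i 1 - 1

theorem act_shiftBy (i : ι) (c : ℤ) (f : (ι → ℤ) → ℂ) (k : ι → ℤ) :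
    act (shiftBy i c) f k = f (k + Pi.single i c) := by
  rw [shiftBy, act_single, one_mul]

theorem shiftBy_mul_shiftBy (i : ι) (c d : ℤ) : shiftBy i c * shiftBy i d = shiftBy i (c + d) := by
  rw [shiftBy, shiftBy, shiftBy, AddMonoidAlgebra.single_mul_single, ← Pi.single_add, one_mul]

theorem shiftBy_zero (i : ι) : shiftBy i 0 = 1 := by
  rw [shiftBy, Pi.single_zero, AddMonoidAlgebra.one_def]

theorem fwd_eq (i : ι) : fwd i = shiftBy i 1 * bwd i := by
  rw [fwd, bwd, mul_sub, shiftBy_mul_shiftBy, add_neg_cancel, shiftBy_zero, mul_one]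

theorem act_fwd (i : ι) (f : (ι → ℤ) → ℂ) (k : ι → ℤ) :
    act (fwd i) f k = f (k + Pi.single i 1) - f k := by
  rw [fwd, map_sub, map_one, LinearMap.sub_apply, Pi.sub_apply, act_shiftBy, Module.End.one_apply]

theorem act_prod_shiftBy (s : Finset ι) (c : ι → ℤ) (f : (ι → ℤ) → ℂ) (k : ι → ℤ) :
    act (∏ i ∈ s, shiftBy i (c i)) f k = f (k + ∑ i ∈ s, Pi.single i (c i)) := by
  induction s using Finset.induction_on generalizing k with
  | empty => simp
  | insert a s ha ih =>
    rw [Finset.prod_insert ha, act_mul_apply, act_shiftBy, ih, Finset.sum_insert ha, add_assoc]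

theorem act_prod_univ_shiftBy [Fintype ι] (c : ι → ℤ) (f : (ι → ℤ) → ℂ) (k : ι → ℤ) :
    act (∏ i, shiftBy i (c i)) f k = f (k + c) := by
  rw [act_prod_shiftBy, Finset.univ_sum_single]

/-- The product `1 + δ_p Δ_q`, which is `V_{p,q}`. -/
noncomputable def strict (p q : ι) : ShiftRing ι := 1 + bwd p * fwd q

theorem strict_eq (p q : ι) : strict p q = shiftBy p (-1) + shiftBy q 1 - shiftBy p (-1) * shiftBy q 1 := by
  rw [strict, bwd, fwd]
  ring

theorem E_eq_act (j : ι) (c : ℤ) : E j c = act (shiftBy j c) := by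
  refine LinearMap.ext fun f => funext fun k => ?_
  rw [act_shiftBy]
  change f _ = f _
  congr 1
  ext i
  by_cases h : i = j
  · subst h
    simp
  · simp [h]

theorem Δ_eq_act (j : ι) : Δ j = act (fwd j) := by
  rw [Δ, fwd, E_eq_act, map_sub, map_one]

theorem δ_eq_act (j : ι) : δ j = act (bwd j) := by
  rw [δ, bwd, E_eq_act, map_sub, map_one]

theorem V_eq_act (p q : ι) : V p q = act (strict p q) := by
  rw [V, strict_eq, E_eq_act, E_eq_act, map_sub, map_add, map_mul]

theorem pushShift_shiftBy (φ : (κ → ℤ) →+ (ι → ℤ)) {i : κ} {j : ι} {c : ℤ}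
    (h : φ (Pi.single i c) = Pi.single j c) : pushShift φ (shiftBy i c) = shiftBy j c := by
  rw [shiftBy, pushShift_single, h, shiftBy]

theorem pushShift_bwd (φ : (κ → ℤ) →+ (ι → ℤ)) {i : κ} {j : ι}
    (h : ∀ c, φ (Pi.single i c) = Pi.single j c) : pushShift φ (bwd i) = bwd j := by
  rw [bwd, map_sub, map_one, pushShift_shiftBy φ (h _), bwd]

theorem pushShift_fwd (φ : (κ → ℤ) →+ (ι → ℤ)) {i : κ} {j : ι}
    (h : ∀ c, φ (Pi.single i c) = Pi.single j c) : pushShift φ (fwd i) = fwd j := by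
  rw [fwd, map_sub, map_one, pushShift_shiftBy φ (h _), fwd]

omit [DecidableEq ι] in
theorem pushShift_bwd_of_eq_zero (φ : (κ → ℤ) →+ (ι → ℤ)) {i : κ}
    (h : ∀ c, φ (Pi.single i c) = 0) : pushShift φ (bwd i) = 0 := by
  rw [bwd, map_sub, map_one, shiftBy, pushShift_single, h, AddMonoidAlgebra.one_def, sub_self]

omit [DecidableEq ι] in
theorem pushShift_fwd_of_eq_zero (φ : (κ → ℤ) →+ (ι → ℤ)) {i : κ}
    (h : ∀ c, φ (Pi.single i c) = 0) : pushShift φ (fwd i) = 0 := by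
  rw [fwd, map_sub, map_one, shiftBy, pushShift_single, h, AddMonoidAlgebra.one_def, sub_self]

theorem pushShift_strict (φ : (κ → ℤ) →+ (ι → ℤ)) {p q : κ} {p' q' : ι}
    (hp : ∀ c, φ (Pi.single p c) = Pi.single p' c) (hq : ∀ c, φ (Pi.single q c) = Pi.single q' c) :
    pushShift φ (strict p q) = strict p' q' := by
  rw [strict, map_add, map_one, map_mul, pushShift_bwd φ hp, pushShift_fwd φ hq, strict]

omit [DecidableEq ι] in
theorem pushShift_strict_left (φ : (κ → ℤ) →+ (ι → ℤ)) {p q : κ}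
    (hp : ∀ c, φ (Pi.single p c) = 0) : pushShift φ (strict p q) = 1 := by
  rw [strict, map_add, map_one, map_mul, pushShift_bwd_of_eq_zero φ hp, zero_mul, add_zero]

omit [DecidableEq ι] in
theorem pushShift_strict_right (φ : (κ → ℤ) →+ (ι → ℤ)) {p q : κ}
    (hq : ∀ c, φ (Pi.single q c) = 0) : pushShift φ (strict p q) = 1 := by
  rw [strict, map_add, map_one, map_mul, pushShift_fwd_of_eq_zero φ hq, mul_zero, add_zero]

theorem reindexHom_single (σ : Equiv.Perm ι) (i : ι) (c : ℤ) :
    reindexHom σ (Pi.single i c) = Pi.single (σ.symm i) c := by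
  ext j
  simp only [reindexHom, AddMonoidHom.coe_mk, ZeroHom.coe_mk, Function.comp_apply, Pi.single_apply,
    Equiv.eq_symm_apply]

end act

/-! ### The operator `∏_{p<q} V_{q,p}` and antisymmetric functions -/

/-- `∏_{p<q} V_{q,p}`. -/
noncomputable def strictProd (n : ℕ) : ShiftRing (Fin n) :=
  ∏ q, ∏ p, if p < q then strict q p else 1

/-- Exchange of the variables `i, j` after the change of variables `k_i + i`. -/
def swapShift {n : ℕ} (i j : Fin n) (k : Fin n → ℤ) : Fin n → ℤ :=
  (k + (Pi.single j 1 - Pi.single i 1)) ∘ Equiv.swap i j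

/-- An adjacent transposition reverses the order of the single pair `(i, j)` and permutes all other
ordered pairs. The extra factor `V_{i,j}` is precisely the image of the one factor `V_{j,i}` that
would otherwise break the symmetry. -/
theorem pushShift_swap_strictProd {n : ℕ} (i j : Fin n) (hij : (i : ℕ) + 1 = j) :
    pushShift (reindexHom (Equiv.swap i j)) (strict i j * strictProd n)
      = strict i j * strictProd n := by
  have hne : i ≠ j := by
    rintro rfl
    omega
  have hs : ∀ p q : Fin n, pushShift (reindexHom (Equiv.swap i j)) (strict q p)
      = strict (Equiv.swap i j q) (Equiv.swap i j p) := fun p q =>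
    pushShift_strict _ (fun c => by rw [reindexHom_single, Equiv.symm_swap])
      (fun c => by rw [reindexHom_single, Equiv.symm_swap])
  have hW : strictProd n = strict j i *
      ∏ x ∈ Finset.univ.filter (fun x : Fin n × Fin n => x.2 < x.1 ∧ x ≠ (j, i)),
        strict x.1 x.2 := by
    rw [strictProd, ← Fintype.prod_prod_type'
      (f := fun q p : Fin n => if p < q then strict q p else 1), ← Finset.prod_filter]
    have : Finset.univ.filter (fun x : Fin n × Fin n => x.2 < x.1) = insert (j, i)
        (Finset.univ.filter (fun x : Fin n × Fin n => x.2 < x.1 ∧ x ≠ (j, i))) := by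
      ext x
      simp only [Finset.mem_filter, Finset.mem_univ, true_and, Finset.mem_insert]
      have : i < j := by
        rw [Fin.lt_def]
        omega
      constructor
      · intro h
        by_cases hx : x = (j, i)
        · exact Or.inl hx
        · exact Or.inr ⟨h, hx⟩
      · rintro (rfl | h)
        · exact this
        · exact h.1
    rw [this, Finset.prod_insert (by simp)]
  rw [hW, map_mul, map_mul, map_prod]
  simp only [hs, Equiv.swap_apply_left, Equiv.swap_apply_right]
  have hR : ∏ x ∈ Finset.univ.filter (fun x : Fin n × Fin n => x.2 < x.1 ∧ x ≠ (j, i)),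
        strict (Equiv.swap i j x.1) (Equiv.swap i j x.2)
      = ∏ x ∈ Finset.univ.filter (fun x : Fin n × Fin n => x.2 < x.1 ∧ x ≠ (j, i)),
        strict x.1 x.2 := by
    refine Finset.prod_equiv (Equiv.prodCongr (Equiv.swap i j) (Equiv.swap i j)) ?_ ?_
    · rintro ⟨q, p⟩
      simp only [Finset.mem_filter, Finset.mem_univ, true_and, Equiv.prodCongr_apply, Prod.map,
        Equiv.swap_apply_def, ne_eq, Prod.mk.injEq, Fin.lt_def, Fin.ext_iff] at hne ⊢
      split_ifs <;> omega
    · intro x _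
      rfl
  rw [hR]
  ring

theorem swapShift_add {n : ℕ} (i j : Fin n) (v w : Fin n → ℤ) :
    swapShift i j (v + w) = swapShift i j v + reindexHom (Equiv.swap i j) w := by
  ext p
  simp [swapShift, reindexHom]
  ring

/-- `∏ V_{q,p}` turns an antisymmetric function into a shift-antisymmetric one. -/
theorem act_strictProd_swap {n : ℕ} {f : (Fin n → ℤ) → ℂ} {i j : Fin n} (hij : (i : ℕ) + 1 = j)
    (hf : ∀ k, f (swapShift i j k) = -f k) (k : Fin n → ℤ) :
    act (strict i j) (act (strictProd n) f) (swapShift i j k)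
      = -act (strict i j) (act (strictProd n) f) k := by
  rw [← act_mul_apply]
  conv_lhs => rw [← pushShift_swap_strictProd i j hij]
  rw [← act_comp (swapShift i j) (reindexHom (Equiv.swap i j)) (swapShift_add i j)]
  simp only [hf]
  rw [show (fun v => -f v) = -f from rfl, map_neg, Pi.neg_apply]

theorem shiftAntisymmetric_iff {n : ℕ} (a : (Fin n → ℤ) → ℂ) : ShiftAntisymmetric a ↔
    ∀ i j : Fin n, (i : ℕ) + 1 = j → ∀ k,
      act (strict i j) a (swapShift i j k) = -act (strict i j) a k := by
  refine forall_congr' fun i => forall_congr' fun j => forall_congr' fun _ => ?_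
  rw [funext_iff]
  refine forall_congr' fun k => ?_
  rw [V_eq_act, E_eq_act, E_eq_act, Module.End.mul_apply, LinearMap.add_apply,
    Module.End.one_apply, Module.End.mul_apply, Module.End.mul_apply, Pi.add_apply, act_shiftBy, act_shiftBy]
  change _ + act (strict i j) a ((k + Pi.single j 1 + Pi.single i (-1)) ∘ Equiv.swap i j) = 0 ↔ _
  rw [show k + Pi.single j 1 + Pi.single i (-1) = k + (Pi.single j 1 - Pi.single i 1) by
    rw [Pi.single_neg]; abel, add_comm, add_eq_zero_iff_eq_neg]
  rfl

/-! ### Determinantal functions -/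

/-- The function `k ↦ det (g_j (k_i + i))`. -/
noncomputable def detFun {n : ℕ} (g : Fin n → ℤ → ℂ) (k : Fin n → ℤ) : ℂ :=
  (Matrix.of fun i j : Fin n => g j (k i + (i : ℕ))).det

/-- In the coordinates `k_i + i` the map `swapShift` is a plain exchange, so it swaps two rows of
the matrix. -/
theorem detFun_swapShift {n : ℕ} (g : Fin n → ℤ → ℂ) (i j : Fin n) (hij : (i : ℕ) + 1 = j)
    (k : Fin n → ℤ) : detFun g (swapShift i j k) = -detFun g k := by
  have hne : i ≠ j := by
    rintro rfl
    omega
  have h := Matrix.det_permute (Equiv.swap i j) (Matrix.of fun i j : Fin n => g j (k i + (i : ℕ)))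
  rw [Equiv.Perm.sign_swap hne] at h
  rw [detFun, detFun]
  refine Eq.trans (congrArg Matrix.det ?_) (h.trans (by simp))
  ext p q
  simp only [Matrix.of_apply, Matrix.submatrix_apply, id, swapShift, Function.comp_apply,
    Pi.add_apply, Pi.sub_apply]
  congr 1
  by_cases hp : p = i
  · subst hp
    rw [Equiv.swap_apply_left, Pi.single_eq_same, Pi.single_eq_of_ne hne.symm]
    omega
  · by_cases hp' : p = j
    · subst hp'
      rw [Equiv.swap_apply_right, Pi.single_eq_same, Pi.single_eq_of_ne hne]
      omega
    · rw [Equiv.swap_apply_of_ne_of_ne hp hp', Pi.single_eq_of_ne hp, Pi.single_eq_of_ne hp']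
      omega

/-- A product of equal first order operators in all variables acts on the columns of a
determinantal function. -/
theorem act_prod_detFun {n : ℕ} (g : Fin n → ℤ → ℂ) (c d : ℂ) :
    act (∏ i : Fin n, (algebraMap ℂ _ c + algebraMap ℂ _ d * shiftBy i 1)) (detFun g)
      = detFun (fun j x => c * g j x + d * g j (x + 1)) := by
  -- The operators are applied one variable at a time. Each variable occurs in one row only, so
  -- linearity of the determinant in that row absorbs the operator.
  have key : ∀ (s : Finset (Fin n)) (k : Fin n → ℤ),
      act (∏ i ∈ s, (algebraMap ℂ _ c + algebraMap ℂ _ d * shiftBy i 1)) (detFun g) k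
        = (Matrix.of fun i j : Fin n => if i ∈ s then
            c * g j (k i + (i : ℕ)) + d * g j (k i + (i : ℕ) + 1) else g j (k i + (i : ℕ))).det := by
    intro s
    induction s using Finset.induction_on with
    | empty =>
      intro k
      simp [detFun]
    | insert a s ha ih =>
      intro k
      rw [Finset.prod_insert ha, act_mul_apply, map_add, map_mul, LinearMap.add_apply,
        AlgHom.commutes, AlgHom.commutes, Module.End.mul_apply, Module.algebraMap_end_apply,
        Module.algebraMap_end_apply, Pi.add_apply, Pi.smul_apply, Pi.smul_apply, act_shiftBy, ih, ih,
        smul_eq_mul, smul_eq_mul]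
      set M := Matrix.of fun i j : Fin n => if i ∈ s then
            c * g j (k i + (i : ℕ)) + d * g j (k i + (i : ℕ) + 1) else g j (k i + (i : ℕ)) with hM
      have h1 : (Matrix.of fun i j : Fin n => if i ∈ s then
            c * g j ((k + (Pi.single a 1 : Fin n → ℤ)) i + (i : ℕ)) + d * g j ((k + (Pi.single a 1 : Fin n → ℤ)) i + (i : ℕ) + 1)
            else g j ((k + (Pi.single a 1 : Fin n → ℤ)) i + (i : ℕ)))
          = M.updateRow a (fun j => g j (k a + (a : ℕ) + 1)) := by
        ext i j
        rw [Matrix.updateRow_apply]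
        by_cases hi : i = a
        · subst hi
          simp only [Matrix.of_apply, if_neg ha, if_true, Pi.add_apply, Pi.single_eq_same]
          congr 1
          ring
        · simp [hM, hi]
      have h2 : M = M.updateRow a (fun j => g j (k a + (a : ℕ))) := by
        ext i j
        rw [Matrix.updateRow_apply]
        by_cases hi : i = a
        · subst hi
          simp [hM, ha]
        · simp [hi]
      have h3 : (Matrix.of fun i j : Fin n => if i ∈ insert a s then
            c * g j (k i + (i : ℕ)) + d * g j (k i + (i : ℕ) + 1) else g j (k i + (i : ℕ)))
          = M.updateRow a (c • (fun j => g j (k a + (a : ℕ)))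
              + d • (fun j => g j (k a + (a : ℕ) + 1))) := by
        ext i j
        rw [Matrix.updateRow_apply]
        by_cases hi : i = a
        · subst hi
          simp
        · simp [hM, hi]
      rw [h1, h3, Matrix.det_updateRow_add, Matrix.det_updateRow_smul, Matrix.det_updateRow_smul,
        ← h2]
  ext k
  rw [key, detFun]
  simp

theorem act_prod_fwd_detFun {n : ℕ} (g : Fin n → ℤ → ℂ) :
    act (∏ i : Fin n, fwd i) (detFun g) = detFun (fun j x => g j (x + 1) - g j x) := by
  have h := act_prod_detFun g (-1) 1
  rw [show (∏ i : Fin n, fwd i) = ∏ i : Fin n, (algebraMap ℂ (ShiftRing (Fin n)) (-1)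
      + algebraMap ℂ _ 1 * shiftBy i 1) from Finset.prod_congr rfl fun i _ => by
        rw [map_neg, map_one, fwd]; ring, h]
  congr 1
  ext j x
  ring

/-! ### The Vandermonde product as a determinant of binomial coefficients -/

/-- The binomial coefficient `x choose j` for an integer `x`. -/
noncomputable def binom (j : ℕ) (x : ℤ) : ℂ := ((Ring.choose x j : ℤ) : ℂ)

theorem binom_zero (x : ℤ) : binom 0 x = 1 := by
  simp [binom]

theorem binom_succ (j : ℕ) (x : ℤ) : binom (j + 1) (x + 1) - binom (j + 1) x = binom j x := by
  rw [binom, binom, binom, Ring.choose_succ_succ]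
  push_cast
  ring

/-- The function `∏_{i<j} (k_j - k_i + j - i) / (j - i)`, written as a determinant. -/
noncomputable def vand (n : ℕ) : (Fin n → ℤ) → ℂ := detFun fun j => binom j

/-- An antidifference of `vand n` in all variables. -/
noncomputable def vandAnti (n : ℕ) : (Fin n → ℤ) → ℂ := detFun fun j => binom (j + 1)

theorem act_prod_fwd_vandAnti (n : ℕ) : act (∏ i, fwd i) (vandAnti n) = vand n := by
  rw [vandAnti, act_prod_fwd_detFun, vand]
  simp only [binom_succ]

/-- By Pascal's rule `Δ` sends column `j` to column `j - 1` and kills column `0`, so `u + wΔ`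
multiplies the matrix on the right by a triangular matrix with diagonal `u`. -/
theorem act_scalar_vand (n : ℕ) (u w : ℂ) :
    act (∏ i : Fin n, (algebraMap ℂ _ u + algebraMap ℂ _ w * fwd i)) (vand n) = u ^ n • vand n := by
  rw [show (∏ i : Fin n, (algebraMap ℂ (ShiftRing (Fin n)) u + algebraMap ℂ _ w * fwd i))
      = ∏ i : Fin n, (algebraMap ℂ _ (u - w) + algebraMap ℂ _ w * shiftBy i 1) from
      Finset.prod_congr rfl fun i _ => by rw [map_sub, fwd]; ring, vand, act_prod_detFun]
  ext k
  let U : Matrix (Fin n) (Fin n) ℂ :=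
    Matrix.of fun a b => if a = b then u else if (a : ℕ) + 1 = b then w else 0
  have hU : U.det = u ^ n := by
    rw [Matrix.det_of_isUpperTriangular]
    · simp [U]
    · intro a b hab
      have hab' : b < a := hab
      rw [Fin.lt_def] at hab'
      simp only [U, Matrix.of_apply]
      rw [if_neg (by rintro rfl; omega), if_neg (by omega)]
  rw [Pi.smul_apply, smul_eq_mul, ← hU, mul_comm, detFun, detFun, ← Matrix.det_mul]
  congr 1
  ext i j
  rw [Matrix.mul_apply]
  simp only [Matrix.of_apply, U]
  obtain ⟨j, hj⟩ := j
  cases j with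
  | zero =>
    rw [Finset.sum_eq_single ⟨0, hj⟩]
    · simp [binom_zero]
    · intro b _ hb
      simp [hb]
    · simp
  | succ j =>
    have hne : (⟨j, by omega⟩ : Fin n) ≠ ⟨j + 1, hj⟩ := by simp
    rw [Finset.sum_eq_add_of_mem (⟨j, by omega⟩ : Fin n) ⟨j + 1, hj⟩ (Finset.mem_univ _)
      (Finset.mem_univ _) hne]
    · have := binom_succ j (k i + (i : ℕ))
      simp only [if_neg hne, if_true]
      rw [← this]
      ring
    · rintro b - ⟨hb, hb'⟩
      rw [if_neg hb', if_neg, mul_zero]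
      intro h
      apply hb
      ext
      simpa using h

/-! ### Symmetric expressions in the differences acting on the Vandermonde product -/

open Polynomial in
/-- The elementary symmetric functions of the differences annihilate `vand n`. -/
theorem act_poly_vand (n : ℕ) (u w : ℂ[X]) (r : ShiftRing (Fin n)) :
    act (∏ i : Fin n, (aeval r u + aeval r w * fwd i)) (vand n) = act (aeval r u ^ n) (vand n) := by
  -- The scalar case says that `P`, evaluated at any complex number, annihilates `vand n`. Every
  -- coefficient of `P` must then annihilate it, so `P` may be evaluated at an arbitrary shift
  -- operator `r`.
  let P : (ShiftRing (Fin n))[X] := ∏ i : Fin n,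
    (u.map (algebraMap ℂ _) + w.map (algebraMap ℂ _) * C (fwd i)) - u.map (algebraMap ℂ _) ^ n
  have hr : ∀ r, P.eval r = ∏ i : Fin n, (aeval r u + aeval r w * fwd i) - aeval r u ^ n := by
    intro r
    simp only [P, eval_sub, eval_prod, eval_add, eval_mul, eval_pow, eval_C, eval_map_algebraMap]
  have hsum : ∀ r k, act (P.eval r) (vand n) k
      = ∑ m ∈ Finset.range (P.natDegree + 1), act (r ^ m) (act (P.coeff m) (vand n)) k := by
    intro r k
    rw [eval_eq_sum_range, map_sum, LinearMap.sum_apply, Finset.sum_apply]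
    refine Finset.sum_congr rfl fun m _ => ?_
    rw [mul_comm, act_mul_apply]
  have hcoeff : ∀ m, act (P.coeff m) (vand n) = 0 := by
    intro m
    ext k
    let Q : ℂ[X] := ∑ m ∈ Finset.range (P.natDegree + 1), C (act (P.coeff m) (vand n) k) * X ^ m
    have hQ : Q = 0 := by
      -- A complex polynomial vanishing at all scalars is zero; this separates the coefficients of
      -- `P` pointwise in `k`.
      refine Polynomial.funext fun τ => ?_
      have h1 := hsum (algebraMap ℂ _ τ) k
      have h2 := act_scalar_vand n (u.eval τ) (w.eval τ)
      rw [hr, map_sub, aeval_algebraMap_apply_eq_algebraMap_eval,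
        aeval_algebraMap_apply_eq_algebraMap_eval, LinearMap.sub_apply, h2, ← map_pow,
        AlgHom.commutes, Module.algebraMap_end_apply, sub_self] at h1
      simp only [Q, eval_finsetSum, eval_mul, eval_C, eval_pow, eval_X, eval_zero]
      refine Eq.trans ?_ h1.symm
      refine Finset.sum_congr rfl fun m _ => ?_
      rw [← map_pow, AlgHom.commutes, Module.algebraMap_end_apply, Pi.smul_apply, smul_eq_mul,
        mul_comm]
    by_cases hm : m ≤ P.natDegree
    · have := congrArg (fun q => coeff q m) hQ
      simpa [Q, finsetSum_coeff, coeff_C_mul, coeff_X_pow, Nat.lt_succ_iff, hm] using this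
    · rw [coeff_eq_zero_of_natDegree_lt (not_le.1 hm)]
      simp
  have : act (P.eval r) (vand n) = 0 := by
    ext k
    rw [hsum]
    simp [hcoeff]
  rw [hr, map_sub, LinearMap.sub_apply, sub_eq_zero] at this
  exact this

theorem act_prod_one_add_fwd_vand (n : ℕ) (r : ShiftRing (Fin n)) :
    act (∏ i : Fin n, (1 + r * fwd i)) (vand n) = vand n := by
  have h := act_poly_vand n 1 Polynomial.X r
  simpa using h

theorem vand_add_one (n : ℕ) (k : Fin n → ℤ) : vand n (k + 1) = vand n k := by
  have h := congrFun (act_prod_one_add_fwd_vand n 1) k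
  rw [← h]
  simp only [one_mul, fwd, add_sub_cancel]
  rw [act_prod_univ_shiftBy (fun _ => 1)]
  rfl

theorem vand_sub_one (n : ℕ) (k : Fin n → ℤ) : vand n (k - 1) = vand n k := by
  rw [← vand_add_one, sub_add_cancel]

/-- Since `1 + rδ = E⁻¹(1 + (1 + r)Δ)`, this reduces to the forward case and the invariance of `vand
n` under simultaneous translation. -/
theorem act_prod_one_add_bwd_vand (n : ℕ) (r : ShiftRing (Fin n)) :
    act (∏ i : Fin n, (1 + r * bwd i)) (vand n) = vand n := by
  have h : ∏ i : Fin n, (1 + r * bwd i)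
      = (∏ i : Fin n, shiftBy i (-1)) * ∏ i : Fin n, (1 + (1 + r) * fwd i) := by
    rw [← Finset.prod_mul_distrib]
    refine Finset.prod_congr rfl fun i _ => ?_
    have : shiftBy i (-1) * shiftBy i 1 = (1 : ShiftRing (Fin n)) := by
      rw [shiftBy_mul_shiftBy, neg_add_cancel, shiftBy_zero]
    rw [bwd, fwd]
    linear_combination (-1 - r) * this
  rw [h, act_mul_apply, act_prod_one_add_fwd_vand]
  ext k
  rw [act_prod_univ_shiftBy (fun _ => -1), ← vand_sub_one n k]
  rfl

theorem act_fwd_pow_vand (n : ℕ) (i : Fin n) : act (fwd i ^ n) (vand n) = 0 := by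
  -- With `u = X`, `w = -1` and `r = Δ_i` the `i`-th factor is `Δ_i - Δ_i = 0`.
  have h := act_poly_vand n Polynomial.X (-1) (fwd i)
  rw [Finset.prod_eq_zero (Finset.mem_univ i) (by simp)] at h
  simpa using h.symm

/-! ### The summation operator applied to iterated differences -/

/-- The arguments `(k_0, …, k_{r-1}, k_{r+1} + 1, …, k_n + 1)`. -/
def omitShift {n : ℕ} (r : Fin (n + 1)) (k : Fin (n + 1) → ℤ) (j : Fin n) : ℤ :=
  k (r.succAbove j) + ((r.succAbove j : ℕ) - (j : ℕ) : ℤ)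

/-- The local form of shift-antisymmetry used in sums over interlacing rows. -/
def DiagonalRelation {n : ℕ} (G : (Fin n → ℤ) → ℂ) : Prop :=
  ∀ i j : Fin n, (i : ℕ) + 1 = j → ∀ k, k i = k j →
    G k + G (k + Pi.single i 1 + Pi.single j 1) = G (k + Pi.single j 1)

/-- If `k_i = k_j`, then `k + e_i` is fixed by `swapShift`, so the antisymmetric function `V_{i,j}
G` vanishes there. Expanding `V_{i,j}` gives the relation. -/
theorem diagonalRelation_of_swap {n : ℕ} {G : (Fin n → ℤ) → ℂ}
    (hG : ∀ i j : Fin n, (i : ℕ) + 1 = j → ∀ k,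
      act (strict i j) G (swapShift i j k) = -act (strict i j) G k) : DiagonalRelation G := by
  intro i j hij k hk
  have hne : i ≠ j := by
    rintro rfl
    omega
  have h := hG i j hij (k + Pi.single i 1)
  have hs : swapShift i j (k + Pi.single i 1) = k + Pi.single i 1 := by
    ext p
    simp only [swapShift, Function.comp_apply, Pi.add_apply, Pi.sub_apply]
    by_cases hp : p = i
    · subst hp
      rw [Equiv.swap_apply_left]
      simp [hne.symm, hk]
    · by_cases hp' : p = j
      · subst hp'
        rw [Equiv.swap_apply_right]
        simp [hne, hk]
      · rw [Equiv.swap_apply_of_ne_of_ne hp hp']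
        simp [hp, hp']
  rw [hs, self_eq_neg, strict_eq, map_sub, map_add, LinearMap.sub_apply, LinearMap.add_apply,
    Pi.sub_apply, Pi.add_apply, act_mul_apply, act_shiftBy, act_shiftBy, act_shiftBy, act_shiftBy,
    show k + Pi.single i 1 + Pi.single i (-1) = k by rw [Pi.single_neg]; abel] at h
  linear_combination h

/-- Appending a zero at the end, as an additive map. -/
def snocHom (n : ℕ) : (Fin n → ℤ) →+ (Fin (n + 1) → ℤ) where
  toFun w := Fin.snoc w 0
  map_zero' := by
    ext i
    refine Fin.lastCases ?_ (fun i => ?_) i <;> simp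
  map_add' v w := by
    ext i
    refine Fin.lastCases ?_ (fun i => ?_) i <;> simp

theorem snocHom_single {n : ℕ} (i : Fin n) (c : ℤ) :
    snocHom n (Pi.single i c) = Pi.single i.castSucc c := by
  ext j
  refine Fin.lastCases ?_ (fun j => ?_) j
  · simp [snocHom]
  · simp [snocHom, Pi.single_apply]

theorem act_snoc {n : ℕ} (a : ShiftRing (Fin n)) (f : (Fin (n + 1) → ℤ) → ℂ) (y : ℤ)
    (v : Fin n → ℤ) : act a (fun v => f (Fin.snoc v y : Fin (n + 1) → ℤ)) v
      = act (pushShift (snocHom n) a) f (Fin.snoc v y : Fin (n + 1) → ℤ) := by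
  refine act_comp (fun v => (Fin.snoc v y : Fin (n + 1) → ℤ)) _ (fun v w => ?_) a f v
  ext i
  refine Fin.lastCases ?_ (fun i => ?_) i <;> simp [snocHom]

theorem act_prod_fwd_snoc {n : ℕ} (G : (Fin (n + 1) → ℤ) → ℂ) (l : Fin n → ℤ) (m : ℤ) :
    act (∏ i, fwd i) G (Fin.snoc l m)
      = act (∏ i, fwd i) (fun l' : Fin n → ℤ => G (Fin.snoc l' (m + 1)) - G (Fin.snoc l' m)) l := by
  have h := act_snoc (∏ i, fwd i) (act (fwd (Fin.last n)) G) m l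
  rw [map_prod (pushShift (snocHom n))] at h
  simp only [pushShift_fwd _ (snocHom_single _)] at h
  rw [Fin.prod_univ_castSucc, act_mul_apply, ← h]
  refine congrArg (fun F => act (∏ i, fwd i) F l) (funext fun l' => ?_)
  rw [act_fwd]
  congr 2
  ext i
  refine Fin.lastCases ?_ (fun i => ?_) i <;> simp

/-- A discrete fundamental theorem of calculus for `sumOp`. The recursion telescopes in the last
variable; the boundary terms caused by strictness of the rows cancel by the diagonal relation. -/
theorem sumOp_prod_fwd {n : ℕ} (G : (Fin n → ℤ) → ℂ) (hG : DiagonalRelation G)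
    (k : Fin (n + 1) → ℤ) :
    sumOp n (act (∏ i, fwd i) G) k = ∑ r : Fin (n + 1), (-1) ^ (r : ℕ) * G (omitShift r k) := by
  induction n with
  | zero =>
    simp [sumOp]
    congr 1
    exact Subsingleton.elim _ _
  | succ n ih =>
    have hG' : ∀ m, DiagonalRelation (fun l => G (Fin.snoc l m)) := by
      intro m i j hij l hl
      have h := hG i.castSucc j.castSucc (by simpa using hij) (Fin.snoc l m) (by simpa using hl)
      have hsn : ∀ (v : Fin n → ℤ) (a : Fin n) (c : ℤ),
          (Fin.snoc v m : Fin (n + 1) → ℤ) + Pi.single a.castSucc c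
            = Fin.snoc (v + Pi.single a c) m := by
        intro v a c
        ext p
        refine Fin.lastCases ?_ (fun p => ?_) p
        · simp
        · simp [Pi.single_apply]
      rwa [hsn, hsn, hsn] at h
    have hdiff : ∀ m m', DiagonalRelation
        (fun l => G (Fin.snoc l m) - G (Fin.snoc l m')) := by
      intro m m' i j hij l hl
      have h1 := hG' m i j hij l hl
      have h2 := hG' m' i j hij l hl
      beta_reduce at h1 h2 ⊢
      linear_combination h1 - h2
    have hA : (fun l : Fin n → ℤ => extSum (k (Fin.last n).castSucc + 1) (k (Fin.last (n + 1)))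
          (fun m => act (∏ i, fwd i) G (Fin.snoc l m)))
        = act (∏ i, fwd i) (fun l => G (Fin.snoc l (k (Fin.last (n + 1)) + 1))
          - G (Fin.snoc l (k (Fin.last n).castSucc + 1))) := by
      ext l
      rw [extSum_eq_sub (F := fun m => act (∏ i, fwd i) (fun l => G (Fin.snoc l (m + 1))) l)]
      · rw [add_sub_cancel_right, ← Pi.sub_apply, ← map_sub]
        rfl
      · intro m
        rw [act_prod_fwd_snoc, ← Pi.sub_apply, ← map_sub, sub_add_cancel]
        rfl
    have hB : (fun l : Fin n → ℤ => act (∏ i, fwd i) G (Fin.snoc l (k (Fin.last n).castSucc)))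
        = act (∏ i, fwd i) (fun l => G (Fin.snoc l (k (Fin.last n).castSucc + 1))
          - G (Fin.snoc l (k (Fin.last n).castSucc))) := by
      ext l
      rw [act_prod_fwd_snoc]
    rw [sumOp, hA, hB, ih _ (hdiff _ _), ih _ (hdiff _ _)]
    rw [Fin.sum_univ_castSucc (n := n + 1)]
    have hlast : omitShift (Fin.last (n + 1)) k = Fin.init k := by
      ext j
      simp [omitShift, Fin.init]
    have hcast : ∀ r : Fin (n + 1), omitShift r.castSucc k
        = Fin.snoc (omitShift r (Fin.init k)) (k (Fin.last (n + 1)) + 1) := by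
      intro r
      ext j
      refine Fin.lastCases ?_ (fun j => ?_) j
      · rw [Fin.snoc_last, omitShift, Fin.succAbove_ne_last_last (Fin.castSucc_lt_last r).ne]
        simp
      · rw [Fin.snoc_castSucc, omitShift, omitShift, Fin.castSucc_succAbove_castSucc]
        rfl
    simp only [hlast, hcast]
    set c := k (Fin.last n).castSucc with hc
    set k' : Fin (n + 1) → ℤ := Function.update (Fin.init k) (Fin.last n) (c - 1) with hk'
    -- What remains after removing the terms with last argument `k_{n+1} + 1`, which match those on
    -- the right. Only `r = n` contributes, giving the term in which the last argument is omitted.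
    suffices h : ∑ r : Fin (n + 1), (-1) ^ (r : ℕ) * (G (Fin.snoc (omitShift r k') (c + 1))
        - G (Fin.snoc (omitShift r k') c) - G (Fin.snoc (omitShift r (Fin.init k)) (c + 1)))
        = (-1) ^ (n + 1) * G (Fin.init k) by
      rw [Fin.val_last, ← h, ← Finset.sum_add_distrib, ← Finset.sum_add_distrib]
      refine Finset.sum_congr rfl fun r _ => ?_
      rw [Fin.val_castSucc]
      ring
    rw [Fin.sum_univ_castSucc, Finset.sum_eq_zero, zero_add]
    · have h1 : ∀ v : Fin (n + 1) → ℤ, omitShift (Fin.last n) v = Fin.init v := by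
        intro v
        ext j
        simp [omitShift, Fin.init]
      have h2 : Fin.snoc (Fin.init (Fin.init k)) c = (Fin.init k : Fin (n + 1) → ℤ) :=
        Fin.snoc_init_self (α := fun _ => ℤ) (Fin.init k)
      rw [h1, h1, hk', Fin.init_update_last, h2, Fin.val_last]
      ring
    · intro r _
      cases n with
      | zero => exact r.elim0
      | succ n =>
        set a := omitShift r.castSucc k' with ha
        have h1 : omitShift r.castSucc (Fin.init k) = a + Pi.single (Fin.last n) 1 := by
          ext j
          rw [ha, Pi.add_apply, omitShift, omitShift, hk']
          refine Fin.lastCases ?_ (fun j => ?_) j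
          · rw [Fin.succAbove_ne_last_last (Fin.castSucc_lt_last r).ne, Function.update_self,
              Pi.single_eq_same]
            simp only [Fin.init, hc]
            ring
          · rw [Function.update_of_ne (Fin.succAbove_ne_last (Fin.castSucc_lt_last r).ne
              (Fin.castSucc_lt_last j).ne), Pi.single_eq_of_ne (Fin.castSucc_lt_last j).ne, add_zero]
        have hal : a (Fin.last n) = c := by
          rw [ha, omitShift, Fin.succAbove_ne_last_last (Fin.castSucc_lt_last r).ne, hk',
            Function.update_self]
          simp
        -- For the other `r` the last two arguments both equal `c`, because lowering to `c - 1` and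
        -- the shift by one in `omitShift` compensate. The diagonal relation makes the bracket
        -- vanish.
        have h := hG (Fin.last n).castSucc (Fin.last (n + 1)) (by simp) (Fin.snoc a c)
          (by simp [hal])
        have e1 : (Fin.snoc a c : Fin (n + 2) → ℤ) + Pi.single (Fin.last n).castSucc 1
            = Fin.snoc (a + Pi.single (Fin.last n) 1) c := by
          ext p
          refine Fin.lastCases ?_ (fun p => ?_) p
          · simp
          · simp [Pi.single_apply]
        have e2 : ∀ v : Fin (n + 1) → ℤ, (Fin.snoc v c : Fin (n + 2) → ℤ)
            + Pi.single (Fin.last (n + 1)) 1 = Fin.snoc v (c + 1) := by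
          intro v
          ext p
          refine Fin.lastCases ?_ (fun p => ?_) p <;> simp
        rw [e1, e2, e2] at h
        rw [h1, ← h]
        ring

/-! ### The operator formula for `α` -/

theorem extSum_cast_complex (a b : ℤ) (f : ℤ → ℤ) :
    ((extSum a b f : ℤ) : ℂ) = extSum a b (fun i => (f i : ℂ)) := by
  unfold extSum
  split_ifs <;> push_cast <;> rfl

theorem sumOp_cast_complex (n : ℕ) (A : (Fin n → ℤ) → ℤ) (k : Fin (n + 1) → ℤ) :
    ((sumOp n A k : ℤ) : ℂ) = sumOp n (fun l => (A l : ℂ)) k := by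
  induction n with
  | zero => rfl
  | succ n ih =>
    simp only [sumOp]
    push_cast
    rw [ih, ih]
    simp only [extSum_cast_complex]

/-- The complex-valued version of `α`. -/
noncomputable def alphaC (n : ℕ) (k : Fin n → ℤ) : ℂ := (alpha n k : ℂ)

theorem reindexHom_succAbove_self {n : ℕ} (r : Fin (n + 1)) (c : ℤ) :
    reindexHom r.succAbove (Pi.single r c) = 0 := by
  ext j
  simp [reindexHom, Fin.succAbove_ne]

theorem reindexHom_succAbove {n : ℕ} (r : Fin (n + 1)) (i : Fin n) (c : ℤ) :
    reindexHom r.succAbove (Pi.single (r.succAbove i) c) = Pi.single i c := by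
  ext j
  simp [reindexHom, Pi.single_apply]

theorem omitShift_add {n : ℕ} (r : Fin (n + 1)) (v w : Fin (n + 1) → ℤ) :
    omitShift r (v + w) = omitShift r v + reindexHom r.succAbove w := by
  ext j
  simp only [omitShift, Pi.add_apply, reindexHom, AddMonoidHom.coe_mk, ZeroHom.coe_mk,
    Function.comp_apply]
  ring

/-- On functions independent of the variable `r` its shift acts as the identity, so every factor `V`
involving `r` becomes `1`. -/
theorem pushShift_succAbove_strictProd {n : ℕ} (r : Fin (n + 1)) :
    pushShift (reindexHom r.succAbove) (strictProd (n + 1)) = strictProd n := by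
  have h0 := reindexHom_succAbove_self r
  have h1 := reindexHom_succAbove r
  simp only [strictProd, map_prod, apply_ite (pushShift _), map_one]
  rw [Fin.prod_univ_succAbove _ r, Finset.prod_eq_one, one_mul]
  · refine Finset.prod_congr rfl fun q _ => ?_
    rw [Fin.prod_univ_succAbove _ r, pushShift_strict_right _ h0, ite_self, one_mul]
    refine Finset.prod_congr rfl fun p _ => ?_
    simp only [pushShift_strict _ (h1 q) (h1 p), Fin.succAbove_lt_succAbove_iff]
  · intro p _
    rw [pushShift_strict_left _ h0, ite_self]

/-- Laplace expansion along the first column, which consists of ones. It has the same shape as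
`sumOp_prod_fwd`, which drives the induction for the operator formula. -/
theorem vand_succ (n : ℕ) (k : Fin (n + 1) → ℤ) :
    vand (n + 1) k = ∑ r : Fin (n + 1), (-1) ^ (r : ℕ) * vandAnti n (omitShift r k) := by
  rw [vand, detFun, Matrix.det_succ_column_zero]
  refine Finset.sum_congr rfl fun r _ => ?_
  simp only [Matrix.of_apply, Fin.val_zero, binom_zero, mul_one]
  congr 1
  rw [vandAnti, detFun]
  congr 1
  ext i j
  simp only [Matrix.of_apply, Matrix.submatrix_apply, omitShift, Fin.val_succ]
  congr 1
  ring

/-- An antidifference of `α` in all variables which is shift-antisymmetric. -/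
noncomputable def alphaAnti (n : ℕ) : (Fin n → ℤ) → ℂ := act (strictProd n) (vandAnti n)

theorem alphaC_succ_of_eq {n : ℕ} (h : alphaC n = act (strictProd n) (vand n))
    (k : Fin (n + 1) → ℤ) :
    alphaC (n + 1) k = ∑ r : Fin (n + 1), (-1) ^ (r : ℕ) * alphaAnti n (omitShift r k) := by
  have h1 : (fun l => (alpha n l : ℂ)) = act (∏ i, fwd i) (alphaAnti n) := by
    rw [alphaAnti, act_comm, act_prod_fwd_vandAnti, ← h]
    rfl
  rw [alphaC, alpha, sumOp_cast_complex, h1]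
  refine sumOp_prod_fwd _ (diagonalRelation_of_swap fun i j hij k => ?_) k
  exact act_strictProd_swap hij (fun k => detFun_swapShift _ i j hij k) k

/-- The operator formula `α(n; k) = ∏_{p<q} V_{q,p} ∏_{i<j} (k_j - k_i + j - i) / (j - i)`. -/
theorem alphaC_eq (n : ℕ) : alphaC n = act (strictProd n) (vand n) := by
  induction n with
  | zero =>
    ext k
    simp [alphaC, alpha, strictProd, vand, detFun]
  | succ n ih =>
    ext k
    have hv : vand (n + 1) = ∑ r : Fin (n + 1), ((-1 : ℂ) ^ (r : ℕ)) •
        (fun k => vandAnti n (omitShift r k)) := by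
      ext k
      rw [vand_succ, Finset.sum_apply]
      rfl
    rw [alphaC_succ_of_eq ih, hv, map_sum, Finset.sum_apply]
    refine Finset.sum_congr rfl fun r _ => ?_
    rw [map_smul, Pi.smul_apply, smul_eq_mul, act_comp _ _ (omitShift_add r),
      pushShift_succAbove_strictProd, alphaAnti]

theorem alphaC_succ (n : ℕ) (k : Fin (n + 1) → ℤ) :
    alphaC (n + 1) k = ∑ r : Fin (n + 1), (-1) ^ (r : ℕ) * alphaAnti n (omitShift r k) :=
  alphaC_succ_of_eq (alphaC_eq n) k

theorem act_prod_fwd_alphaAnti (n : ℕ) : act (∏ i, fwd i) (alphaAnti n) = alphaC n := by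
  rw [alphaAnti, act_comm, act_prod_fwd_vandAnti, alphaC_eq]

theorem shiftAntisymmetric_alphaC (n : ℕ) : ShiftAntisymmetric (alphaC n) := by
  rw [alphaC_eq, shiftAntisymmetric_iff]
  exact fun i j hij => act_strictProd_swap hij fun k => detFun_swapShift _ i j hij k

theorem alphaC_add_one (n : ℕ) (k : Fin n → ℤ) : alphaC n (k + 1) = alphaC n k := by
  have h : ∀ (f : (Fin n → ℤ) → ℂ) k, act (∏ i, shiftBy i 1) f k = f (k + 1) := by
    intro f k
    rw [act_prod_univ_shiftBy (fun _ => 1)]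
    rfl
  have hv : act (∏ i, shiftBy i 1) (vand n) = vand n := by
    ext k
    rw [h, vand_add_one]
  rw [← h (alphaC n), alphaC_eq, act_comm, hv]

/-! ### Circular shift -/

/-- On functions killed by a power of `Δ_i` the operator `δ_i Δ_i` is nilpotent, so `1 + δ_i Δ_i`
can be cancelled. -/
theorem eq_of_act_one_add {n : ℕ} {i : Fin n} {m : ℕ} {f g : (Fin n → ℤ) → ℂ}
    (h : act (1 + bwd i * fwd i) f = act (1 + bwd i * fwd i) g)
    (hf : act (fwd i ^ m) f = 0) (hg : act (fwd i ^ m) g = 0) : f = g := by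
  rw [← sub_eq_zero] at h ⊢
  rw [← map_sub, map_add, map_one, LinearMap.add_apply, Module.End.one_apply] at h
  have hx : ∀ l : ℕ, act ((bwd i * fwd i) ^ l) (f - g) = (-1 : ℂ) ^ l • (f - g) := by
    intro l
    induction l with
    | zero => simp
    | succ l ih =>
      rw [pow_succ, act_mul_apply, ← neg_eq_of_add_eq_zero_right h, map_neg, ih, pow_succ,
        mul_neg_one, neg_smul]
  have h0 := hx m
  rw [mul_pow, act_mul_apply, map_sub (act (fwd i ^ m)), hf, hg, sub_zero, map_zero] at h0
  exact (smul_eq_zero.1 h0.symm).resolve_left (pow_ne_zero _ (by norm_num))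

theorem act_prod_strict_zero_vand (n : ℕ) :
    act (∏ p : Fin n, strict 0 p.succ) (vand (n + 1))
      = act (∏ p : Fin n, strict p.succ 0) (vand (n + 1)) := by
  refine eq_of_act_one_add (i := 0) (m := n + 1) ?_ ?_ ?_
  -- After multiplication by the missing factor `1 + δ_0 Δ_0`, the two products become `∏ (1 +
  -- rΔ_p)` with `r = δ_0` and `∏ (1 + rδ_p)` with `r = Δ_0`, over all `p`. Both fix the Vandermonde
  -- product.
  · rw [← act_mul_apply, ← act_mul_apply]
    have h1 := act_prod_one_add_fwd_vand (n + 1) (bwd 0)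
    have h2 := act_prod_one_add_bwd_vand (n + 1) (fwd 0)
    rw [Fin.prod_univ_succ] at h1 h2
    simp only [strict]
    rw [h1]
    simp only [mul_comm (fwd (0 : Fin (n + 1)))] at h2
    rw [h2]
  · rw [act_comm, act_fwd_pow_vand, map_zero]
  · rw [act_comm, act_fwd_pow_vand, map_zero]

theorem finRotate_castSucc {n : ℕ} (p : Fin n) : finRotate (n + 1) p.castSucc = p.succ := by
  ext
  rw [coe_finRotate_of_ne_last (Fin.castSucc_lt_last p).ne, Fin.val_castSucc, Fin.val_succ]

theorem strictProd_succ (n : ℕ) : strictProd (n + 1) = (∏ q : Fin n, strict q.succ 0) *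
    ∏ q : Fin n, ∏ p : Fin n, if p < q then strict q.succ p.succ else 1 := by
  rw [strictProd, Fin.prod_univ_succ, Finset.prod_eq_one (by simp), one_mul,
    ← Finset.prod_mul_distrib]
  refine Finset.prod_congr rfl fun q _ => ?_
  rw [Fin.prod_univ_succ, if_pos (Fin.succ_pos q)]
  simp only [Fin.succ_lt_succ_iff]

/-- The arguments `(k_1, …, k_n, k_0 - (n + 1))`. -/
def rotateShift {n : ℕ} (k : Fin (n + 1) → ℤ) : Fin (n + 1) → ℤ :=
  (k - Pi.single 0 ((n : ℤ) + 1)) ∘ finRotate (n + 1)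

theorem rotateShift_cons {n : ℕ} (u : ℤ) (v : Fin n → ℤ) :
    rotateShift (Fin.cons u v) = Fin.snoc v (u - ((n : ℤ) + 1)) := by
  ext j
  refine Fin.lastCases ?_ (fun j => ?_) j
  · simp [rotateShift]
  · simp [rotateShift]

/-- In the coordinates `k_i + i`, and after translating all arguments by `-1`, this is a cyclic
permutation of `n + 1` rows, of sign `(-1)^n`. -/
theorem vand_rotateShift (n : ℕ) (k : Fin (n + 1) → ℤ) :
    vand (n + 1) (rotateShift k) = (-1) ^ n * vand (n + 1) k := by
  rw [← vand_sub_one (n + 1) k, vand, detFun, detFun]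
  have h := Matrix.det_permute (finRotate (n + 1)) (Matrix.of fun i j : Fin (n + 1) =>
    binom j ((k - 1) i + (i : ℕ)))
  rw [sign_finRotate, add_tsub_cancel_right] at h
  refine Eq.trans (congrArg Matrix.det ?_) (h.trans (by simp))
  ext i j
  simp only [Matrix.of_apply, Matrix.submatrix_apply, id, rotateShift, Function.comp_apply,
    Pi.sub_apply, Pi.one_apply]
  congr 1
  refine Fin.lastCases ?_ (fun i => ?_) i
  · simp
    ring
  · rw [finRotate_castSucc, Pi.single_eq_of_ne (Fin.succ_ne_zero i), Fin.val_castSucc,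
      Fin.val_succ]
    push_cast
    ring

/-- `α(n + 1; k_1, …, k_n, k_0 - (n + 1)) = (-1)^n α(n + 1; k_0, …, k_n)`. -/
theorem alphaC_snoc (n : ℕ) (u : ℤ) (v : Fin n → ℤ) :
    alphaC (n + 1) (Fin.snoc v (u - ((n : ℤ) + 1)) : Fin (n + 1) → ℤ)
      = (-1) ^ n * alphaC (n + 1) (Fin.cons u v : Fin (n + 1) → ℤ) := by
  -- The operator product with its variables relabelled by the rotation. Now `0` comes last in the
  -- order, so `b` differs from `strictProd` only in having `V_{0,p}` in place of `V_{p,0}`.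
  let b : ShiftRing (Fin (n + 1)) := ∏ q, ∏ p,
    if p < q then strict (finRotate (n + 1) q) (finRotate (n + 1) p) else 1
  have hb : pushShift (reindexHom (finRotate (n + 1))) b = strictProd (n + 1) := by
    simp only [b, map_prod, apply_ite (pushShift _), map_one, strictProd]
    refine Finset.prod_congr rfl fun q _ => Finset.prod_congr rfl fun p _ => ?_
    rw [pushShift_strict (p' := q) (q' := p)] <;>
    · intro c
      rw [reindexHom_single, Equiv.symm_apply_apply]
  have hb' : b = (∏ p : Fin n, strict 0 p.succ) *
      ∏ q : Fin n, ∏ p : Fin n, if p < q then strict q.succ p.succ else 1 := by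
    simp only [b]
    rw [Fin.prod_univ_castSucc, mul_comm, Fin.prod_univ_castSucc, if_neg (lt_irrefl _), mul_one]
    congr 1
    · refine Finset.prod_congr rfl fun p _ => ?_
      rw [if_pos (Fin.castSucc_lt_last p), finRotate_last, finRotate_castSucc]
    · refine Finset.prod_congr rfl fun q _ => ?_
      rw [Fin.prod_univ_castSucc, if_neg (not_lt.2 (Fin.le_last _)), mul_one]
      simp only [finRotate_castSucc, Fin.castSucc_lt_castSucc_iff]
  have h := act_comp (rotateShift (n := n)) (reindexHom (finRotate (n + 1))) (fun v w => by
    ext p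
    simp only [rotateShift, reindexHom, Function.comp_apply, Pi.add_apply, Pi.sub_apply,
      AddMonoidHom.coe_mk, ZeroHom.coe_mk]
    ring) b (vand (n + 1)) (Fin.cons u v)
  rw [hb, rotateShift_cons, ← alphaC_eq] at h
  simp only [vand_rotateShift] at h
  rw [← h, show (fun v => (-1) ^ n * vand (n + 1) v) = (-1 : ℂ) ^ n • vand (n + 1) from rfl,
    map_smul, Pi.smul_apply, smul_eq_mul, alphaC_eq, hb', strictProd_succ,
    mul_comm (∏ p, strict 0 _), mul_comm (∏ q, strict _ 0), act_mul_apply, act_mul_apply,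
    act_prod_strict_zero_vand]

/-! ### Reduction of `α` by difference operators -/

/-- Prepending a zero, as an additive map. -/
def consHom (n : ℕ) : (Fin n → ℤ) →+ (Fin (n + 1) → ℤ) where
  toFun w := Fin.cons 0 w
  map_zero' := by
    ext i
    refine Fin.cases ?_ (fun i => ?_) i <;> simp
  map_add' v w := by
    ext i
    refine Fin.cases ?_ (fun i => ?_) i <;> simp

theorem consHom_single {n : ℕ} (i : Fin n) (c : ℤ) :
    consHom n (Pi.single i c) = Pi.single i.succ c := by
  ext j
  refine Fin.cases ?_ (fun j => ?_) j
  · simp [consHom, (Fin.succ_ne_zero i).symm]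
  · simp [consHom, Pi.single_apply]

theorem act_cons {n : ℕ} (a : ShiftRing (Fin n)) (f : (Fin (n + 1) → ℤ) → ℂ) (u : ℤ)
    (v : Fin n → ℤ) : act a (fun v => f (Fin.cons u v : Fin (n + 1) → ℤ)) v
      = act (pushShift (consHom n) a) f (Fin.cons u v : Fin (n + 1) → ℤ) := by
  refine act_comp (fun v => (Fin.cons u v : Fin (n + 1) → ℤ)) _ (fun v w => ?_) a f v
  ext i
  refine Fin.cases ?_ (fun i => ?_) i <;> simp [consHom]

theorem act_prod_shiftBy_succ {n : ℕ} (c : Fin n → ℤ) (f : (Fin (n + 1) → ℤ) → ℂ) (u : ℤ)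
    (v : Fin n → ℤ) : act (∏ i, shiftBy i.succ (c i)) f (Fin.cons u v : Fin (n + 1) → ℤ)
      = f (Fin.cons u (v + c) : Fin (n + 1) → ℤ) := by
  have h := act_cons (∏ i, shiftBy i (c i)) f u v
  rw [map_prod (pushShift (consHom n)), act_prod_univ_shiftBy] at h
  simp only [pushShift_shiftBy _ (consHom_single _ _)] at h
  exact h.symm

theorem shiftAntisymmetric_alphaC_cons (n : ℕ) (u : ℤ) :
    ShiftAntisymmetric fun v : Fin n → ℤ => alphaC (n + 1) (Fin.cons u v : Fin (n + 1) → ℤ) := by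
  rw [shiftAntisymmetric_iff]
  intro i j hij k
  rw [act_cons, act_cons, pushShift_strict _ (consHom_single _) (consHom_single _),
    ← (shiftAntisymmetric_iff _).1 (shiftAntisymmetric_alphaC (n + 1)) i.succ j.succ
      (by rw [Fin.val_succ, Fin.val_succ, hij])]
  refine congrArg _ ?_
  ext p
  refine Fin.cases ?_ (fun p => ?_) p
  · rw [Fin.cons_zero, swapShift, Function.comp_apply, Equiv.swap_apply_of_ne_of_ne
      (Fin.succ_ne_zero i).symm (Fin.succ_ne_zero j).symm]
    simp [(Fin.succ_ne_zero _).symm]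
  · rw [Fin.cons_succ, swapShift, swapShift, Function.comp_apply, Function.comp_apply,
      ← (Fin.succ_injective n).map_swap]
    simp [Pi.single_apply]

/-- In the alternating sum for α each difference kills the term that omits its variable. Only the
terms omitting `u` or `v 0` survive, and their difference telescopes to a sum of smaller α's. -/
theorem act_prod_bwd_alphaC (n : ℕ) (u : ℤ) (v : Fin (n + 1) → ℤ) :
    act (∏ i : Fin n, bwd i.succ) (fun v => alphaC (n + 2) (Fin.cons u v : Fin (n + 2) → ℤ)) v
      = extSum u (v 0) fun l => alphaC (n + 1) (Fin.cons l (Fin.tail v) : Fin (n + 1) → ℤ) := by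
  set P : ShiftRing (Fin (n + 1)) := ∏ i : Fin n, bwd i.succ with hP
  set G := alphaAnti (n + 1) with hG
  have hsum : alphaC (n + 2) = ∑ r : Fin (n + 2), ((-1 : ℂ) ^ (r : ℕ)) •
      (fun k => G (omitShift r k)) := by
    ext k
    rw [alphaC_succ, Finset.sum_apply]
    rfl
  have hr : ∀ r : Fin (n + 2), act (∏ i : Fin n, bwd i.succ.succ) (fun k => G (omitShift r k))
      = fun k => act (∏ i : Fin n, pushShift (reindexHom r.succAbove) (bwd i.succ.succ)) G
        (omitShift r k) := by
    intro r
    ext k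
    rw [act_comp _ _ (omitShift_add r), map_prod (pushShift _)]
  have h0 : ∏ i : Fin n, pushShift (reindexHom (0 : Fin (n + 2)).succAbove) (bwd i.succ.succ)
      = P := by
    refine Finset.prod_congr rfl fun i _ => pushShift_bwd _ fun c => ?_
    exact reindexHom_succAbove (0 : Fin (n + 2)) i.succ c
  have h1 : ∏ i : Fin n, pushShift (reindexHom (1 : Fin (n + 2)).succAbove) (bwd i.succ.succ)
      = P := by
    refine Finset.prod_congr rfl fun i _ => pushShift_bwd _ fun c => ?_
    have := reindexHom_succAbove (1 : Fin (n + 2)) i.succ c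
    rwa [Fin.one_succAbove_succ] at this
  have h2 : ∀ r : Fin n, ∏ i : Fin n,
      pushShift (reindexHom r.succ.succ.succAbove) (bwd i.succ.succ) = 0 := by
    intro r
    refine Finset.prod_eq_zero (Finset.mem_univ r) ?_
    exact pushShift_bwd_of_eq_zero _ (reindexHom_succAbove_self _)
  rw [act_cons, hP, map_prod (pushShift (consHom (n + 1)))]
  simp only [pushShift_bwd _ (consHom_single _)]
  rw [hsum, map_sum, Fin.sum_univ_succ, Fin.sum_univ_succ, Finset.sum_eq_zero]
  · simp only [map_smul, hr]
    rw [Fin.succ_zero_eq_one, h0, h1]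
    have hlast : omitShift 0 (Fin.cons u v : Fin (n + 2) → ℤ)
        = Fin.cons (v 0 + 1) (Fin.tail v + 1) := by
      ext j
      refine Fin.cases ?_ (fun j => ?_) j <;> simp [omitShift, Fin.tail]
    have hfirst : omitShift 1 (Fin.cons u v : Fin (n + 2) → ℤ)
        = Fin.cons u (Fin.tail v + 1) := by
      ext j
      refine Fin.cases ?_ (fun j => ?_) j <;> simp [omitShift, Fin.tail]
    rw [extSum_eq_sub (F := fun x => act P G (Fin.cons (x + 1) (Fin.tail v + 1)))]
    · simp [hlast, hfirst, sub_eq_add_neg]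
    -- The increment of `F` is one more difference, in the variable `0`. The argument `tail v + 1`
    -- turns each `δ` into `Δ`, so all differences of `alphaAnti` together give α.
    · intro x
      rw [← act_prod_fwd_alphaAnti, Fin.prod_univ_succ]
      simp only [fwd_eq (Fin.succ _)]
      rw [Finset.prod_mul_distrib, ← mul_assoc, mul_comm (fwd 0), mul_assoc, act_mul_apply,
        act_prod_shiftBy_succ (fun _ => 1), act_mul_apply, act_fwd]
      have hc : (Fin.cons x (Fin.tail v + fun _ => 1) : Fin (n + 1) → ℤ) + Pi.single 0 1
          = Fin.cons (x + 1) (Fin.tail v + 1) := by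
        ext j
        refine Fin.cases ?_ (fun j => ?_) j <;> simp
      rw [hc, sub_add_cancel]
      rfl
  · intro r _
    rw [map_smul, hr, h2]
    simp only [map_zero, LinearMap.zero_apply, Pi.zero_apply]
    exact smul_zero _

theorem exists_sub_eq {M : Type*} [AddCommGroup M] (f : ℤ → M) :
    ∃ F : ℤ → M, ∀ x, F x - F (x - 1) = f x := by
  refine ⟨fun x => if 0 ≤ x then ∑ i ∈ Finset.Icc 1 x, f i else -∑ i ∈ Finset.Icc (x + 1) 0, f i,
    fun x => ?_⟩
  beta_reduce
  rcases lt_trichotomy x 0 with hx | rfl | hx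
  · rw [if_neg (by omega), if_neg (by omega), sub_add_cancel,
      show Finset.Icc x 0 = insert x (Finset.Icc (x + 1) 0) by
        ext y
        simp only [Finset.mem_Icc, Finset.mem_insert]
        omega, Finset.sum_insert (by simp)]
    abel
  · simp
  · rw [if_pos (by omega), if_pos (by omega),
      show Finset.Icc 1 x = insert x (Finset.Icc 1 (x - 1)) by
        ext y
        simp only [Finset.mem_Icc, Finset.mem_insert]
        omega, Finset.sum_insert (by simp)]
    abel

/-- Circular symmetry moves the last argument to the front, making `u` the first of the remaining
variables, so the backward reduction applies. -/
theorem act_prod_fwd_alphaC (n : ℕ) (u : ℤ) (v : Fin (n + 1) → ℤ) :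
    act (∏ i : Fin n, -fwd i.castSucc)
        (fun v => alphaC (n + 2) (Fin.cons u v : Fin (n + 2) → ℤ)) v
      = extSum u (v (Fin.last n) + n)
        fun l => alphaC (n + 1) (Fin.cons l (Fin.init v) : Fin (n + 1) → ℤ) := by
  obtain ⟨w, y, rfl⟩ : ∃ w y, v = (Fin.snoc w y : Fin (n + 1) → ℤ) :=
    ⟨Fin.init v, v (Fin.last n), (Fin.snoc_init_self v).symm⟩
  rw [Fin.snoc_last, Fin.init_snoc]
  have h := act_snoc (∏ i : Fin n, -fwd i)
    (fun v => alphaC (n + 2) (Fin.cons u v : Fin (n + 2) → ℤ)) y w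
  rw [map_prod (pushShift (snocHom n))] at h
  simp only [map_neg, pushShift_fwd _ (snocHom_single _)] at h
  rw [← h]
  set Y : ℤ := y + n + 2 with hY
  have hcyc : (fun w : Fin n → ℤ => alphaC (n + 2)
      (Fin.cons u (Fin.snoc w y : Fin (n + 1) → ℤ) : Fin (n + 2) → ℤ))
      = (-1 : ℂ) ^ (n + 1) • fun w => (fun v => alphaC (n + 2) (Fin.cons Y v : Fin (n + 2) → ℤ))
        (Fin.cons u w : Fin (n + 1) → ℤ) := by
    ext w
    have := alphaC_snoc (n + 1) Y (Fin.cons u w : Fin (n + 1) → ℤ)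
    rw [Pi.smul_apply, smul_eq_mul, ← this, Fin.cons_snoc_eq_snoc_cons]
    congr 2
    rw [hY]
    push_cast
    ring
  have hneg : ∏ i : Fin n, -fwd i = algebraMap ℂ (ShiftRing (Fin n)) ((-1) ^ n) * ∏ i, fwd i := by
    rw [Finset.prod_neg, Finset.card_univ, Fintype.card_fin, map_pow, map_neg, map_one]
  rw [hcyc, map_smul, Pi.smul_apply, hneg, act_mul_apply, AlgHom.commutes,
    Module.algebraMap_end_apply, Pi.smul_apply,
    act_cons _ (fun v => alphaC (n + 2) (Fin.cons Y v : Fin (n + 2) → ℤ)),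
    map_prod (pushShift (consHom n))]
  simp only [pushShift_fwd _ (consHom_single _), fwd_eq (Fin.succ _)]
  rw [Finset.prod_mul_distrib, act_mul_apply, act_prod_shiftBy_succ (fun _ => 1),
    act_prod_bwd_alphaC, Fin.cons_zero, Fin.tail_cons]
  obtain ⟨F, hF⟩ := exists_sub_eq fun l => alphaC (n + 1) (Fin.cons l w : Fin (n + 1) → ℤ)
  -- The signs `(-1)^{n+1}` and `(-1)^n` leave minus the sum from `Y` to `u`, which is the sum from
  -- `u + 1` to `Y - 1`. The `Δ = Eδ` shifts raise the other arguments by one; translation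
  -- invariance moves the range to `u, …, Y - 2 = y + n`.
  rw [extSum_eq_sub hF, extSum_eq_sub (F := fun x => F (x - 1))]
  · rw [smul_smul, pow_succ, mul_neg_one, neg_mul, ← mul_pow, neg_one_mul, neg_neg, one_pow, hY,
      show y + n + 2 - 1 - 1 = y + n by ring]
    simp
  · intro x
    rw [hF, ← alphaC_add_one]
    congr 1
    ext j
    refine Fin.cases ?_ (fun j => ?_) j <;> simp

/-! ### Iterating the reductions -/

theorem act_extSum {ι : Type*} (a : ShiftRing ι) (b c : ℤ) (f : ℤ → (ι → ℤ) → ℂ) (k : ι → ℤ) :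
    act a (fun w => extSum b c fun l => f l w) k = extSum b c fun l => act a (f l) k := by
  unfold extSum
  split_ifs
  · rw [show (fun w => ∑ l ∈ Finset.Icc b c, f l w) = ∑ l ∈ Finset.Icc b c, f l by
      ext w; rw [Finset.sum_apply], map_sum, Finset.sum_apply]
  · rw [show (fun w => -∑ l ∈ Finset.Icc (c + 1) (b - 1), f l w)
        = -∑ l ∈ Finset.Icc (c + 1) (b - 1), f l by
      ext w; rw [Pi.neg_apply, Finset.sum_apply], map_neg, map_sum, Pi.neg_apply, Finset.sum_apply]

theorem alphaC_cons_even (n : ℕ) (u : ℤ) (v : Fin n → ℤ) (hv : ∀ i, v i = 2 * (i : ℕ) + 4) :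
    alphaC (n + 1) (Fin.cons u v : Fin (n + 1) → ℤ) = (alphaRow (n + 1) 2 u : ℂ) := by
  rw [alphaC, alphaRow]
  congr 2
  ext j
  refine Fin.cases ?_ (fun j => ?_) j
  · simp
  · simp only [Fin.cons_succ, hv, Fin.val_succ, Nat.add_eq_zero_iff, one_ne_zero, and_false,
      if_false]
    push_cast
    ring

theorem extSum_cast_smul (b c : ℤ) (s : ℕ) (f : ℤ → ℤ) :
    extSum b c (fun l => (-1 : ℂ) ^ s * (f l : ℂ)) = (-1) ^ (s + 1) * ((invDiff c f b : ℤ) : ℂ) := by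
  rw [invDiff, Int.cast_neg, extSum_cast_complex, pow_succ]
  unfold extSum
  split_ifs
  · rw [← Finset.mul_sum]
    ring
  · rw [← Finset.mul_sum]
    ring

theorem act_prod_bwd_pow (x : ℤ → ℤ) (hx : ∀ j < 0, x j = -2 * j + 1) (s N : ℕ) (hs : s ≤ N)
    (u : ℤ) (v : Fin N → ℤ) (hv₁ : ∀ i : Fin N, (i : ℕ) < s → v i = 2 * s + 1 - 2 * (i : ℕ))
    (hv₂ : ∀ i : Fin N, s ≤ (i : ℕ) → v i = 2 * ((i : ℕ) - s) + 4) :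
    act (∏ i : Fin N, bwd i ^ min (i : ℕ) s)
        (fun v => alphaC (N + 1) (Fin.cons u v : Fin (N + 1) → ℤ)) v
      = (-1) ^ s * ((invDiffIter x s (alphaRow (N - s + 1) 2) u : ℤ) : ℂ) := by
  induction s generalizing N u with
  | zero =>
    simp only [Nat.min_zero, pow_zero, Finset.prod_const_one, map_one, Module.End.one_apply,
      one_mul, invDiffIter]
    exact alphaC_cons_even N u v fun i => by simpa using hv₂ i (Nat.zero_le _)
  | succ s ih =>
    obtain ⟨N, rfl⟩ : ∃ M, N = M + 1 := ⟨N - 1, by omega⟩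
    -- The first entry is the upper limit of the next sum; this is where `x_j = -2j + 1` enters.
    have hv0 : v 0 = x (-((s : ℤ) + 1)) := by
      rw [hv₁ 0 (Nat.succ_pos s), hx _ (by omega)]
      push_cast
      simp
      ring
    obtain ⟨y, w, rfl⟩ : ∃ y w, v = (Fin.cons y w : Fin (N + 1) → ℤ) :=
      ⟨v 0, Fin.tail v, (Fin.cons_self_tail v).symm⟩
    -- The exponents `0, 1, …, s + 1, s + 1, …` split into one `δ` for each variable but the first,
    -- and the same pattern for `s` on the remaining variables.
    have hprod : ∏ i : Fin (N + 1), bwd i ^ min (i : ℕ) (s + 1)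
        = (∏ i : Fin N, bwd i.succ ^ min (i : ℕ) s) * ∏ i : Fin N, bwd i.succ := by
      rw [Fin.prod_univ_succ, Fin.val_zero, Nat.zero_min, pow_zero, one_mul,
        ← Finset.prod_mul_distrib]
      refine Finset.prod_congr rfl fun i _ => ?_
      rw [Fin.val_succ, Nat.add_min_add_right, pow_succ]
    have h := act_cons (∏ i : Fin N, bwd i ^ min (i : ℕ) s) (fun v => extSum u (v 0) fun l =>
      alphaC (N + 1) (Fin.cons l (Fin.tail v) : Fin (N + 1) → ℤ)) y w
    rw [map_prod (pushShift (consHom N))] at h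
    simp only [map_pow, pushShift_bwd _ (consHom_single _), Fin.cons_zero, Fin.tail_cons] at h
    rw [hprod, act_mul_apply, funext (act_prod_bwd_alphaC N u), ← h, act_extSum, Nat.add_sub_add_right,
      invDiffIter, ← hv0, Fin.cons_zero, ← extSum_cast_smul]
    congr 1
    ext l
    refine ih N (by omega) l w (fun i hi => ?_) fun i hi => ?_
    · have := hv₁ i.succ (by simpa using hi)
      rw [Fin.cons_succ, Fin.val_succ] at this
      push_cast at this
      omega
    · have := hv₂ i.succ (by simpa using hi)
      rw [Fin.cons_succ, Fin.val_succ] at this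
      push_cast at this
      omega

theorem act_prod_fwd_pow (s N : ℕ) (z : ℤ → ℤ)
    (hz : ∀ j < 0, z j = 3 * ((N : ℤ) - s + 1) + j + 1) (hs : s ≤ N)
    (u : ℤ) (v : Fin N → ℤ) (hv₁ : ∀ i : Fin N, (i : ℕ) + s < N → v i = 2 * (i : ℕ) + 4)
    (hv₂ : ∀ i : Fin N, N ≤ (i : ℕ) + s → v i = 4 * ((N : ℤ) - s) + 3 - 2 * (i : ℕ)) :
    act (∏ i : Fin N, (-fwd i) ^ min (N - 1 - (i : ℕ)) s)
        (fun v => alphaC (N + 1) (Fin.cons u v : Fin (N + 1) → ℤ)) v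
      = (-1) ^ s * ((invDiffIter z s (alphaRow (N - s + 1) 2) u : ℤ) : ℂ) := by
  induction s generalizing N u with
  | zero =>
    simp only [Nat.min_zero, pow_zero, Finset.prod_const_one, map_one, Module.End.one_apply,
      one_mul, invDiffIter]
    exact alphaC_cons_even N u v fun i => by simpa using hv₁ i (by simp)
  | succ s ih =>
    obtain ⟨N, rfl⟩ : ∃ M, N = M + 1 := ⟨N - 1, by omega⟩
    -- The last entry plus the offset from the forward reduction is the next limit. The size `N - s
    -- + 1` of the final row, hence the sequence `z`, does not change during the induction.
    have hv0 : v (Fin.last N) + N = z (-((s : ℤ) + 1)) := by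
      rw [hv₂ _ (by simp), hz _ (by omega), Fin.val_last]
      push_cast
      ring
    obtain ⟨y, w, rfl⟩ : ∃ y w, v = (Fin.snoc w y : Fin (N + 1) → ℤ) :=
      ⟨v (Fin.last N), Fin.init v, (Fin.snoc_init_self v).symm⟩
    have hprod : ∏ i : Fin (N + 1), (-fwd i) ^ min (N + 1 - 1 - (i : ℕ)) (s + 1)
        = (∏ i : Fin N, (-fwd i.castSucc) ^ min (N - 1 - (i : ℕ)) s)
          * ∏ i : Fin N, -fwd i.castSucc := by
      rw [Fin.prod_univ_castSucc, Fin.val_last, Nat.add_sub_cancel, Nat.sub_self, Nat.zero_min,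
        pow_zero, mul_one, ← Finset.prod_mul_distrib]
      refine Finset.prod_congr rfl fun i _ => ?_
      have hi := i.2
      rw [Fin.val_castSucc, show N - (i : ℕ) = N - 1 - i + 1 by omega, Nat.add_min_add_right,
        pow_succ]
    have h := act_snoc (∏ i : Fin N, (-fwd i) ^ min (N - 1 - (i : ℕ)) s)
      (fun v => extSum u (v (Fin.last N) + N) fun l =>
        alphaC (N + 1) (Fin.cons l (Fin.init v) : Fin (N + 1) → ℤ)) y w
    rw [map_prod (pushShift (snocHom N))] at h
    simp only [map_pow, map_neg, pushShift_fwd _ (snocHom_single _), Fin.snoc_last,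
      Fin.init_snoc] at h
    rw [hprod, act_mul_apply, funext (act_prod_fwd_alphaC N u), ← h, act_extSum,
      Nat.add_sub_add_right, invDiffIter, ← hv0, Fin.snoc_last, ← extSum_cast_smul]
    congr 1
    ext l
    refine ih N (fun j hj => ?_) (by omega) l w (fun i hi => ?_) fun i hi => ?_
    · rw [hz j hj]
      push_cast
      ring
    · have := hv₁ i.castSucc (by rw [Fin.val_castSucc]; omega)
      rwa [Fin.snoc_castSucc, Fin.val_castSucc] at this
    · have := hv₂ i.castSucc (by rw [Fin.val_castSucc]; omega)
      rw [Fin.snoc_castSucc, Fin.val_castSucc] at this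
      push_cast at this
      omega

/-! ### The two sides of the operator conjecture for `α` -/

theorem exists_polynomial_alphaC_cons (n : ℕ) (u : ℤ) : ∃ P : MvPolynomial (Fin n) ℂ,
    ∀ v : Fin n → ℤ, alphaC (n + 1) (Fin.cons u v : Fin (n + 1) → ℤ)
      = MvPolynomial.eval (fun j => (v j : ℂ)) P := by
  have h : IsPolyFun fun v : Fin n → ℤ =>
      ((alpha (n + 1) (Fin.cons u v : Fin (n + 1) → ℤ) : ℤ) : ℚ) := by
    refine IsPolyFun.comp (f := fun k => (alpha (n + 1) k : ℚ)) (exists_polynomial_alpha (n + 1))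
      (g := fun v => (Fin.cons u v : Fin (n + 1) → ℤ)) fun j => ?_
    refine Fin.cases ?_ (fun j => ?_) j
    · simpa using isPolyFun_const (u : ℚ)
    · simpa using isPolyFun_coord j
  obtain ⟨P, hP⟩ := h
  refine ⟨MvPolynomial.map (algebraMap ℚ ℂ) P, fun v => ?_⟩
  have := congrArg (algebraMap ℚ ℂ) (hP v)
  rw [MvPolynomial.eval_map, alphaC]
  rw [MvPolynomial.eval, MvPolynomial.coe_eval₂Hom, MvPolynomial.eval₂_comp_left] at this
  simpa [Function.comp_def] using this

/-- `Fin.append` of the two blocks of variables, as an additive map. -/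
def appendHom (s r : ℕ) : (Fin s ⊕ Fin r → ℤ) →+ (Fin (s + r) → ℤ) where
  toFun v := Fin.append (v ∘ Sum.inl) (v ∘ Sum.inr)
  map_zero' := by
    ext i
    refine Fin.addCases (fun i => ?_) (fun i => ?_) i <;> simp
  map_add' v w := by
    ext i
    refine Fin.addCases (fun i => ?_) (fun i => ?_) i <;> simp

theorem appendHom_inl {s r : ℕ} (i : Fin s) (c : ℤ) :
    appendHom s r (Pi.single (Sum.inl i) c) = Pi.single (Fin.castAdd r i) c := by
  ext j
  refine Fin.addCases (fun j => ?_) (fun j => ?_) j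
  · simp [appendHom, Pi.single_apply]
  · simp [appendHom, Pi.single_apply, Fin.ext_iff]
    omega

theorem appendHom_inr {s r : ℕ} (i : Fin r) (c : ℤ) :
    appendHom s r (Pi.single (Sum.inr i) c) = Pi.single (Fin.natAdd s i) c := by
  ext j
  refine Fin.addCases (fun j => ?_) (fun j => ?_) j
  · simp [appendHom, Pi.single_apply, Fin.ext_iff]
    omega
  · simp [appendHom, Pi.single_apply]

/-- `Fin.append` of the two blocks of variables in reverse order, as an additive map. -/
def appendRevHom (s r : ℕ) : (Fin s ⊕ Fin r → ℤ) →+ (Fin (s + r) → ℤ) where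
  toFun v := Fin.append (v ∘ Sum.inr) (v ∘ Sum.inl) ∘ Fin.cast (Nat.add_comm s r)
  map_zero' := by
    ext i
    simp only [Function.comp_apply]
    refine Fin.addCases (fun i => ?_) (fun i => ?_) (Fin.cast (Nat.add_comm s r) i) <;> simp
  map_add' v w := by
    ext i
    simp only [Function.comp_apply, Pi.add_apply]
    refine Fin.addCases (fun i => ?_) (fun i => ?_) (Fin.cast (Nat.add_comm s r) i) <;> simp

theorem appendRevHom_inl {s r : ℕ} (i : Fin s) (c : ℤ) :
    appendRevHom s r (Pi.single (Sum.inl i) c)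
      = Pi.single (Fin.cast (Nat.add_comm r s) (Fin.natAdd r i)) c := by
  ext j
  obtain ⟨j, rfl⟩ := (finCongr (Nat.add_comm r s)).surjective j
  refine Fin.addCases (fun j => ?_) (fun j => ?_) j
  · simp [appendRevHom, Pi.single_apply, Fin.ext_iff]
    omega
  · simp [appendRevHom, Pi.single_apply, Fin.ext_iff]

theorem appendRevHom_inr {s r : ℕ} (i : Fin r) (c : ℤ) :
    appendRevHom s r (Pi.single (Sum.inr i) c)
      = Pi.single (Fin.cast (Nat.add_comm r s) (Fin.castAdd s i)) c := by
  ext j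
  obtain ⟨j, rfl⟩ := (finCongr (Nat.add_comm r s)).surjective j
  refine Fin.addCases (fun j => ?_) (fun j => ?_) j
  · simp [appendRevHom, Pi.single_apply, Fin.ext_iff]
  · simp [appendRevHom, Pi.single_apply, Fin.ext_iff]
    omega

/-- With all variables set to `0` the shifts become the evaluation point. The two blocks of
exponents, `i - 1` for `y_i` and `s` for `k_i`, merge into `min i s`. -/
theorem opLeft_substYK (s t : ℕ) (a : (Fin (s + (t - 1)) → ℤ) → ℂ) :
    opLeft s t (substYK a) (fun _ => 0) = act (∏ i : Fin (s + (t - 1)), bwd i ^ min (i : ℕ) s) a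
      (fun i => if (i : ℕ) < s then 2 * s + 1 - 2 * (i : ℕ) else 2 * ((i : ℕ) - s) + 4) := by
  set c : Fin (s + (t - 1)) → ℤ :=
    fun i => if (i : ℕ) < s then 2 * s + 1 - 2 * (i : ℕ) else 2 * ((i : ℕ) - s) + 4 with hc
  have h := act_comp (appendHom s (t - 1)) (appendHom s (t - 1)) (map_add _)
    ((∏ i : Fin s, shiftBy (Sum.inl i) (2 * s + 3 - 2 * ((i : ℤ) + 1)) * bwd (Sum.inl i) ^ (i : ℕ)) *
      ∏ i : Fin (t - 1), shiftBy (Sum.inr i) (2 * ((i : ℤ) + 2)) * bwd (Sum.inr i) ^ s) a 0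
  have hprod : pushShift (appendHom s (t - 1))
      ((∏ i : Fin s, shiftBy (Sum.inl i) (2 * s + 3 - 2 * ((i : ℤ) + 1))
        * bwd (Sum.inl i) ^ (i : ℕ)) *
      ∏ i : Fin (t - 1), shiftBy (Sum.inr i) (2 * ((i : ℤ) + 2)) * bwd (Sum.inr i) ^ s)
      = (∏ i, shiftBy i (c i)) * ∏ i : Fin (s + (t - 1)), bwd i ^ min (i : ℕ) s := by
    rw [← Finset.prod_mul_distrib, Fin.prod_univ_add, map_mul, map_prod, map_prod]
    congr 1
    · refine Finset.prod_congr rfl fun i _ => ?_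
      rw [map_mul, map_pow, pushShift_shiftBy _ (appendHom_inl _ _),
        pushShift_bwd _ (appendHom_inl _), Fin.val_castAdd, min_eq_left i.2.le, hc]
      simp only [Fin.val_castAdd, i.2, if_true]
      congr 2
      ring
    · refine Finset.prod_congr rfl fun i _ => ?_
      rw [map_mul, map_pow, pushShift_shiftBy _ (appendHom_inr _ _),
        pushShift_bwd _ (appendHom_inr _), Fin.val_natAdd, min_eq_right (Nat.le_add_right _ _), hc]
      simp only [Fin.val_natAdd, add_lt_iff_neg_left, Nat.not_lt_zero, if_false]
      congr 2
      push_cast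
      ring
  rw [hprod, act_mul_apply (∏ i, shiftBy i (c i)), act_prod_univ_shiftBy, map_zero, zero_add] at h
  rw [← h, opLeft]
  simp only [E_eq_act, δ_eq_act, ← map_pow, ← map_mul, prodOp_act]
  rfl

theorem opRight_substKY (s t : ℕ) (ht : 1 ≤ t) (a : (Fin (s + (t - 1)) → ℤ) → ℂ) :
    opRight s t (substKY a) (fun _ => 0)
      = act (∏ i : Fin (s + (t - 1)), (-fwd i) ^ min (s + (t - 1) - 1 - (i : ℕ)) s) a
        (fun i => if (i : ℕ) < t - 1 then 2 * (i : ℕ) + 4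
          else 4 * ((t : ℤ) - 1) + 3 - 2 * (i : ℕ)) := by
  set c : Fin (s + (t - 1)) → ℤ := fun i => if (i : ℕ) < t - 1 then 2 * (i : ℕ) + 4
    else 4 * ((t : ℤ) - 1) + 3 - 2 * (i : ℕ) with hc
  have h := act_comp (appendRevHom s (t - 1)) (appendRevHom s (t - 1)) (map_add _)
    ((∏ i : Fin (t - 1), shiftBy (Sum.inr i) (2 * ((i : ℤ) + 2)) * (-fwd (Sum.inr i)) ^ s) *
      ∏ i : Fin s, shiftBy (Sum.inl i) (2 * t + 3 - 2 * ((i : ℤ) + 1))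
        * (-fwd (Sum.inl i)) ^ (s - ((i : ℕ) + 1))) a 0
  have hprod : pushShift (appendRevHom s (t - 1))
      ((∏ i : Fin (t - 1), shiftBy (Sum.inr i) (2 * ((i : ℤ) + 2)) * (-fwd (Sum.inr i)) ^ s) *
      ∏ i : Fin s, shiftBy (Sum.inl i) (2 * t + 3 - 2 * ((i : ℤ) + 1))
        * (-fwd (Sum.inl i)) ^ (s - ((i : ℕ) + 1)))
      = (∏ i, shiftBy i (c i)) * ∏ i : Fin (s + (t - 1)),
        (-fwd i) ^ min (s + (t - 1) - 1 - (i : ℕ)) s := by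
    rw [← Finset.prod_mul_distrib, ← (finCongr (Nat.add_comm (t - 1) s)).prod_comp,
      Fin.prod_univ_add, map_mul, map_prod, map_prod]
    simp only [finCongr_apply]
    congr 1
    · refine Finset.prod_congr rfl fun i _ => ?_
      have hi := i.2
      rw [map_mul, map_pow, map_neg, pushShift_shiftBy _ (appendRevHom_inr _ _),
        pushShift_fwd _ (appendRevHom_inr _), Fin.val_cast, Fin.val_castAdd,
        min_eq_right (show s ≤ s + (t - 1) - 1 - (i : ℕ) by omega), hc]
      simp only [Fin.val_cast, Fin.val_castAdd, hi, if_true]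
      congr 2
    · refine Finset.prod_congr rfl fun i _ => ?_
      have hi := i.2
      rw [map_mul, map_pow, map_neg, pushShift_shiftBy _ (appendRevHom_inl _ _),
        pushShift_fwd _ (appendRevHom_inl _), Fin.val_cast, Fin.val_natAdd,
        show min (s + (t - 1) - 1 - (t - 1 + (i : ℕ))) s = s - ((i : ℕ) + 1) by omega, hc]
      simp only [Fin.val_cast, Fin.val_natAdd, add_lt_iff_neg_left, Nat.not_lt_zero, if_false]
      congr 2
      push_cast [ht]
      ring
  rw [hprod, act_mul_apply (∏ i, shiftBy i (c i)), act_prod_univ_shiftBy, map_zero, zero_add] at h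
  rw [← h, opRight]
  simp only [E_eq_act, Δ_eq_act, ← map_neg, ← map_pow, ← map_mul, prodOp_act]
  rfl

theorem invDiffIter_eq_of_operatorConjecture (hconj : OperatorConjecture) (x z : ℤ → ℤ) (s n : ℕ)
    (hs : 1 ≤ s) (hsn : s ≤ n) (hx : ∀ j < 0, x j = -2 * j + 1)
    (hz : ∀ j < 0, z j = 3 * n + j + 1) :
    invDiffIter x s (alphaRow n 2) = invDiffIter z s (alphaRow n 2) := by
  ext u
  obtain ⟨P, hP⟩ := exists_polynomial_alphaC_cons (s + (n - 1)) u
  -- The frozen argument `u` is a parameter, so this one instance gives equality of the two iterated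
  -- inverse differences at every `u`.
  have h := hconj s n hs hsn P _ hP (shiftAntisymmetric_alphaC_cons _ u) 0
  have hn : s + (n - 1) - s + 1 = n := by omega
  rw [opLeft_substYK, opRight_substKY _ _ (hs.trans hsn),
    act_prod_bwd_pow x hx s _ (Nat.le_add_right _ _), act_prod_fwd_pow s _ z _
      (Nat.le_add_right _ _), hn] at h
  · exact_mod_cast mul_left_cancel₀ (pow_ne_zero s (by norm_num : (-1 : ℂ) ≠ 0)) h
  · intro i hi
    rw [if_pos (by omega)]
  · intro i hi
    rw [if_neg (by omega)]
    push_cast [hs.trans hsn]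
    ring
  · intro j hj
    rw [hz j hj]
    push_cast [hs.trans hsn]
    ring
  · intro i hi
    rw [if_pos hi]
  · intro i hi
    rw [if_neg (not_lt.2 hi)]

theorem invDiffIter_congr {M : Type*} [AddCommGroup M] {x z : ℤ → ℤ} (h : ∀ j < 0, x j = z j)
    (m : ℕ) (p : ℤ → M) : invDiffIter x m p = invDiffIter z m p := by
  induction m with
  | zero => rfl
  | succ m ih => rw [invDiffIter, invDiffIter, ih, h _ (by omega)]

end VSASM

theorem proposition7p3 (hconj : VSASM.OperatorConjecture)
    (x : ℤ → ℤ) (hx : ∀ j < 0, x j = -2 * j + 1)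
    (n : ℕ) (z : ℤ → ℤ) (hz : ∀ j < 0, z j = 3 * n + j + 1)
    (i : ℤ) (hi : -(n : ℤ) ≤ i) (hi' : i ≤ -1) :
    VSASM.diffPow x i (VSASM.alphaRow n 2) (3 * n + 2 + i) = 0 ∧
    (∀ k₁ : ℤ, VSASM.diffPow x i (VSASM.alphaRow n 2) k₁ =
      VSASM.diffPow z i (VSASM.alphaRow n 2) k₁) ∧
    VSASM.Cnum x n 2 i = VSASM.Dnum x n 2 i := by
  obtain ⟨m, rfl⟩ := Int.eq_negSucc_of_lt_zero (show i < 0 by omega)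
  have h := VSASM.invDiffIter_eq_of_operatorConjecture hconj x z (m + 1) n (by omega)
    (by rw [Int.negSucc_eq] at hi; omega) hx hz
  refine ⟨?_, fun k₁ => congrFun h k₁, ?_⟩
  -- After passing to `z`, the outermost sum runs from `3n + 2 + i` to `z_i = 3n + i + 1` and is
  -- empty.
  · rw [VSASM.diffPow, h, VSASM.invDiffIter, VSASM.invDiff, hz _ (by omega), VSASM.extSum,
      if_pos (by rw [Int.negSucc_eq]; omega), Finset.Icc_eq_empty (by rw [Int.negSucc_eq]; omega)]
    simp
  · rw [VSASM.Cnum, VSASM.Dnum, VSASM.diffPow, VSASM.diffPow, h]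
    -- For `x_j = -2j + 1` the sequence `3(n + 2) - x_j - j - 4` equals `3n + j + 1`.
    refine congrArg (fun p : ℤ → ℤ => _ * p _) (VSASM.invDiffIter_congr (fun j hj => ?_) _ _)
    rw [hz j hj, hx j hj]
    ring
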